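/- Let $p$ be a prime. Write $|\cdot|$ for the $p$-adic absolute value, for the supremum norm on $\mathbb{Q}_p^m$, and for Haar measure on $\mathbb{Q}_p^m$ (normalised so that $|\mathbb{Z}_p^m|=1$); balls $B(c,r)$ are taken in the supremum norm, and $\|\mathbf a\|=\max_i|a_i|_\infty$ for an integer vector $\mathbf a$. **Assumptions.** Let $\mathbf U\subset\mathbb{Q}_p^m$ be an open box (a product of balls of $\mathbb{Q}_p$), and let $\mathbf f=(f_1,\dots,f_n):\mathbf U\to\mathbb{Q}_p^n$ and $\Theta:\mathbf U\to\mathbb{Q}_p$ be analytic maps that extend analytically to the boundary of $\mathbf U$. Assume that the restrictions of $1,f_1,\dots,f_n$ to any nonempty open subset of $\mathbf U$ are linearly independent over $\mathbb{Q}_p$, and that for $g=\mathbf f$ and for $g=\Theta$, on $\mathbf U$: $\|g\|\le 1$, $\|\nabla g\|\le1$, and every second-order difference quotient of $g$ (twice in one variable, or once in each of two different variables) has norm at most $\tfrac12$. Let $\mathbf x_0\in\mathbf U$ be a point where the derivative of $\mathbf f$ is nonzero, and suppose that $\mathbf f$ is *nice* at $\mathbf x_0$: there are a neighbourhood $\mathbf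 V\subset\mathbf U$ of $\mathbf x_0$ and $0<\delta,w<1$ such that for every sufficiently small ball $B\subset\mathbf V$ $$\limsup_{Q\to\infty}\big|\Phi(Q,\delta)\cap B\big|\le w|B|,$$ where $\Phi(Q,\delta)$ is the set of $\mathbf x\in\mathbf U$ for which there is $(a_0,\mathbf a_1)\in\mathbb{Z}\times(\mathbb{Z}^n\setminus\{0\})$ with $|a_0+\mathbf a_1\cdot\mathbf f(\mathbf x)|_p<\delta Q^{-(n+1)}$ and $\|(a_0,\mathbf a_1)\|\le Q$. **Conclusion.** There are a ball $\mathbf U_0\subset\mathbf U$ centred at $\mathbf x_0$, constants $\kappa_0,\kappa_1>0$, and, for each function $F=a_0+a_1f_1+\dots+a_nf_n$ with $\mathbf a=(a_0,\dots,a_n)\in\mathbb{Z}^{n+1}\setminus\{0\}$, a set $$R_F\subset\{\mathbf x\in\mathbf U:(F+\Theta)(\mathbf x)=0\}\cap\mathbf U_0,$$ such that the system $(R_F)_F$ with weights $\beta_F=\kappa_0\|\mathbf a\|$ is locally ubiquitous in $\mathbf U_0$ relative to $\rho(r)=\kappa_1r^{-(n+1)}$, with common dimension $\gamma=m-1$.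 **Local ubiquity** means the following. Put $\Delta(A,r)=\{\mathbf x\in\mathbf U_0:\operatorname{dist}(\mathbf x,A)<r\}$ (empty if $A=\emptyset$) and $J_t=\{F:\beta_F\le2^t\}$, $t\in\mathbb{N}$. Then $\rho>0$ on $(0,\infty)$ and $\rho(r)\to0$ as $r\to\infty$; all $\beta_F$ are positive; every $J_t$ is finite; $0\le\gamma\le m$; and there are constants $c_1,c_2,k>0$ such that 1. (intersection) for all sufficiently large $t$, all $F\in J_t$, all $c\in R_F$ and all $0<\lambda\le\rho(2^t)$, $$\big|B(c,\tfrac12\rho(2^t))\cap\Delta(R_F,\lambda)\big|\ge c_1|B(c,\lambda)|\Big(\frac{\rho(2^t)}{\lambda}\Big)^{\gamma},$$ $$\big|B\cap B(c,3\rho(2^t))\cap\Delta(R_F,3\lambda)\big|\le c_2|B(c,\lambda)|\Big(\frac{r(B)}{\lambda}\Big)^{\gamma}$$ for every ball $B$ of radius $0<r(B)\le3\rho(2^t)$ centred at a point of some $R_{F'}$; 2. (covering) for every ball $B\subset\mathbf U_0$, $$\liminf_{t\to\infty}\Big|\bigcup_{F\in J_t}\Delta(R_F,\rho(2^t))\cap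 B\Big|\ge k|B|.$$ -/

import Mathlib

open MeasureTheory Filter Topology

namespace PadicUbiquity

/-! ### Haar measure on `ℚ_p` and `ℚ_p^m` -/

noncomputable section

variable (p : ℕ) [Fact p.Prime]

instance instMeasurableSpacePadic : MeasurableSpace ℚ_[p] := borel ℚ_[p]

instance instBorelSpacePadic : BorelSpace ℚ_[p] := ⟨rfl⟩

/-- The ring of integers `ℤ_p`, as a compact set with nonempty interior. -/
def unitBall : TopologicalSpace.PositiveCompacts ℚ_[p] where
  carrier := Metric.closedBall 0 1
  isCompact' := isCompact_closedBall 0 1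
  interior_nonempty' :=
    ⟨0, mem_interior.2 ⟨Metric.ball 0 1, Metric.ball_subset_closedBall, Metric.isOpen_ball,
      Metric.mem_ball_self one_pos⟩⟩

/-- Haar measure on `ℚ_p`, normalised so that `ℤ_p` has measure `1`. Through Mathlib's product
instance, `volume` on `Fin m → ℚ_[p]` is then the product measure. -/
instance instMeasureSpacePadic : MeasureSpace ℚ_[p] where
  volume := Measure.addHaarMeasure (unitBall p)

instance instIsAddHaarMeasurePadic : (volume : Measure ℚ_[p]).IsAddHaarMeasure :=
  inferInstanceAs (Measure.addHaarMeasure (unitBall p)).IsAddHaarMeasure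

end

variable {p : ℕ} [Fact p.Prime] {m n : ℕ}

/-! ### The standing assumptions on the domain and on the maps -/

/-- The open box `∏ B(c_i, r_i)` in `ℚ_p^m`. -/
def openBox (c : Fin m → ℚ_[p]) (r : Fin m → ℝ) : Set (Fin m → ℚ_[p]) :=
  Set.univ.pi fun i => Metric.ball (c i) (r i)

section Maps

variable {E : Type*} [NormedAddCommGroup E] [NormedSpace ℚ_[p] E]

/-- `g` is analytic on `U` and extends analytically to the boundary of `U`. -/
def AnalyticUpToBoundary (U : Set (Fin m → ℚ_[p])) (g : (Fin m → ℚ_[p]) → E) : Prop :=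
  ∃ h : (Fin m → ℚ_[p]) → E, AnalyticOnNhd ℚ_[p] h (closure U) ∧ Set.EqOn h g U

/-- First difference quotient of `g` in the `j`-th variable; the `j`-th coordinate of `x` is
irrelevant. -/
noncomputable def diffQuot (j : Fin m) (g : (Fin m → ℚ_[p]) → E) (x : Fin m → ℚ_[p])
    (s t : ℚ_[p]) : E :=
  (s - t)⁻¹ • (g (Function.update x j s) - g (Function.update x j t))

/-- Second difference quotient of `g`, twice in the `j`-th variable. -/
noncomputable def diffQuotTwice (j : Fin m) (g : (Fin m → ℚ_[p]) → E) (x : Fin m → ℚ_[p])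
    (s t u : ℚ_[p]) : E :=
  (s - t)⁻¹ • (diffQuot j g x s u - diffQuot j g x t u)

/-- Second difference quotient of `g`, once in the `i`-th and once in the `j`-th variable. -/
noncomputable def diffQuotMixed (i j : Fin m) (g : (Fin m → ℚ_[p]) → E) (x : Fin m → ℚ_[p])
    (s t s' t' : ℚ_[p]) : E :=
  (s - t)⁻¹ • (diffQuot j g (Function.update x i s) s' t' -
    diffQuot j g (Function.update x i t) s' t')

/-- The size conditions on `U`: `‖g‖ ≤ 1`, `‖∇g‖ ≤ 1` (all first partial derivatives have norm at
most `1`), and every second difference quotient with distinct nodes in `U` has norm at most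
`1/2`. -/
structure UnitBounded (U : Set (Fin m → ℚ_[p])) (g : (Fin m → ℚ_[p]) → E) : Prop where
  norm_le : ∀ x ∈ U, ‖g x‖ ≤ 1
  grad_le : ∀ x ∈ U, ∀ j : Fin m, ‖fderiv ℚ_[p] g x (Pi.single j 1)‖ ≤ 1
  twice_le : ∀ (j : Fin m) (x : Fin m → ℚ_[p]) (s t u : ℚ_[p]),
    Function.update x j s ∈ U → Function.update x j t ∈ U → Function.update x j u ∈ U →
    s ≠ t → s ≠ u → t ≠ u → ‖diffQuotTwice j g x s t u‖ ≤ 1 / 2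
  mixed_le : ∀ (i j : Fin m) (x : Fin m → ℚ_[p]) (s t s' t' : ℚ_[p]), i ≠ j →
    Function.update (Function.update x i s) j s' ∈ U →
    Function.update (Function.update x i s) j t' ∈ U →
    Function.update (Function.update x i t) j s' ∈ U →
    Function.update (Function.update x i t) j t' ∈ U →
    s ≠ t → s' ≠ t' → ‖diffQuotMixed i j g x s t s' t'‖ ≤ 1 / 2

end Maps

/-- The restrictions of `1, f_1, …, f_n` to any nonempty open subset of `U` are linearly
independent over `ℚ_p`. -/
def LocallyIndependent (U : Set (Fin m → ℚ_[p])) (f : (Fin m → ℚ_[p]) → (Fin n → ℚ_[p])) :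
    Prop :=
  ∀ V : Set (Fin m → ℚ_[p]), IsOpen V → V.Nonempty → V ⊆ U →
    LinearIndependent ℚ_[p]
      (Fin.cons (fun _ => 1) (fun i (x : V) => f x i) : Fin (n + 1) → (V → ℚ_[p]))

/-! ### Linear forms and nice maps -/

/-- `F(x) = a_0 + a_1 f_1(x) + ⋯ + a_n f_n(x)` for an integer vector `a = (a_0, …, a_n)`. -/
noncomputable def linForm (f : (Fin m → ℚ_[p]) → (Fin n → ℚ_[p])) (a : Fin (n + 1) → ℤ)
    (x : Fin m → ℚ_[p]) : ℚ_[p] :=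
  (a 0 : ℚ_[p]) + ∑ i : Fin n, (a i.succ : ℚ_[p]) * f x i

/-- The set of `x ∈ U` for which some `a ∈ ℤ × (ℤ^n ∖ {0})` with `‖a‖ ≤ Q` (supremum of the usual
absolute values) satisfies `|a_0 + a_1 f_1(x) + ⋯ + a_n f_n(x)|_p < δ Q^{-(n+1)}`. -/
def smallValueSet (U : Set (Fin m → ℚ_[p])) (f : (Fin m → ℚ_[p]) → (Fin n → ℚ_[p]))
    (Q δ : ℝ) : Set (Fin m → ℚ_[p]) :=
  {x ∈ U | ∃ a : Fin (n + 1) → ℤ, (∃ i : Fin n, a i.succ ≠ 0) ∧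
    ‖linForm f a x‖ < δ * (Q ^ (n + 1))⁻¹ ∧ ‖a‖ ≤ Q}

/-- `f` is nice at `x₀`. -/
def NiceAt (U : Set (Fin m → ℚ_[p])) (f : (Fin m → ℚ_[p]) → (Fin n → ℚ_[p]))
    (x₀ : Fin m → ℚ_[p]) : Prop :=
  ∃ U₀ ∈ 𝓝 x₀, U₀ ⊆ U ∧ ∃ δ w : ℝ, 0 < δ ∧ δ < 1 ∧ 0 < w ∧ w < 1 ∧
    ∃ ε : ℝ, 0 < ε ∧ ∀ (y : Fin m → ℚ_[p]) (r : ℝ), 0 < r → r < ε → Metric.ball y r ⊆ U₀ →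
      limsup (fun Q : ℝ => volume (smallValueSet U f Q δ ∩ Metric.ball y r)) atTop ≤
        ENNReal.ofReal w * volume (Metric.ball y r)

/-! ### Ubiquitous systems -/

/-- `Δ(A, r)`: the points of `U` at distance less than `r` from `A`. It is empty if `A` is, as the
distance to the empty set is `∞`. -/
def nbhd (U A : Set (Fin m → ℚ_[p])) (r : ℝ) : Set (Fin m → ℚ_[p]) :=
  U ∩ Metric.thickening r A

/-- The system `(R, β)` of resonant sets `R α` with weights `β α` is locally ubiquitous in the ball
`U` relative to `ρ`, with common dimension `γ`. -/
structure IsLocallyUbiquitous {J : Type*} [Countable J] (U : Set (Fin m → ℚ_[p]))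
    (R : J → Set (Fin m → ℚ_[p])) (β : J → ℝ) (ρ : ℝ → ℝ) (γ : ℝ) : Prop where
  rho_pos : ∀ r, 0 < r → 0 < ρ r
  rho_tendsto : Tendsto ρ atTop (𝓝 0)
  weight_pos : ∀ α, 0 < β α
  finite_weight_le : ∀ t : ℕ, {α | β α ≤ 2 ^ t}.Finite
  dim_nonneg : 0 ≤ γ
  dim_le : γ ≤ m
  /-- The two intersection conditions; in the second one the ball `B(y, r)` is centred at a point
  `y` of some resonant set. -/
  intersection : ∃ c₁ c₂ : ℝ, 0 < c₁ ∧ 0 < c₂ ∧ ∃ T : ℕ, ∀ t : ℕ, T ≤ t →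
    ∀ α, β α ≤ 2 ^ t → ∀ c ∈ R α, ∀ l : ℝ, 0 < l → l ≤ ρ (2 ^ t) →
      ENNReal.ofReal c₁ * volume (Metric.ball c l) * ENNReal.ofReal ((ρ (2 ^ t) / l) ^ γ) ≤
          volume (Metric.ball c (1 / 2 * ρ (2 ^ t)) ∩ nbhd U (R α) l) ∧
      ∀ α', ∀ y ∈ R α', ∀ r : ℝ, 0 < r → r ≤ 3 * ρ (2 ^ t) →
        volume (Metric.ball y r ∩ Metric.ball c (3 * ρ (2 ^ t)) ∩ nbhd U (R α) (3 * l)) ≤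
          ENNReal.ofReal c₂ * volume (Metric.ball c l) * ENNReal.ofReal ((r / l) ^ γ)
  /-- The covering condition. -/
  covering : ∃ k : ℝ, 0 < k ∧ ∀ (y : Fin m → ℚ_[p]) (r : ℝ), 0 < r → Metric.ball y r ⊆ U →
    ENNReal.ofReal k * volume (Metric.ball y r) ≤
      liminf (fun t : ℕ =>
        volume ((⋃ α ∈ {α | β α ≤ 2 ^ t}, nbhd U (R α) (ρ (2 ^ t))) ∩ Metric.ball y r)) atTop

end PadicUbiquity

/-!
# Local ubiquity of the zero sets of `F + Θ`

Choose a coordinate `j` with `d = ∂_j f(x₀) ≠ 0`, and keep only the functions `F + Θ` whose `j`-th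
partial derivative at `x₀` has absolute value at least `‖d‖`; the others get an empty resonant set.
Integers have `p`-adic absolute value at most `1`, so the strict differentiability of `f` and `Θ` at
`x₀` gives one ball `B(x₀, r₀)` on which all these functions are uniformly Lipschitz, are uniformly
bi-Lipschitz along the `j`-th coordinate, and have a zero at distance `≪ |(F + Θ)(x)|` from each `x`
where they are small (`exists_regularAlong`).

*Intersection.* The zero set of such a function is a graph over the coordinates other than the
`j`-th. A neighbourhood of it of width `l` is compared with a ball by translating it by multiples of
`e_j`: about `r / l` translates cover a ball of radius comparable to `r`
(`volume_le_of_large_fibers`), and about `r / l` translates are disjoint inside a ball of radius `r`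
(`volume_le_of_small_fibers`).

*Covering.* As `f` is nice at `x₀`, for large `Q` a positive proportion of every ball consists of
points `x` at which no nonzero `a` with `‖a‖ ≤ Q` satisfies `|a · (1, f(x))| < δ Q^{-(n+1)}`.
For such an `x` the vectors with `|a · (1, f(x))| ≤ p^{-k}`, where `p^k` is about `Q^{n+1}`, form
a lattice of index `p^k` with no short vectors, and a growth argument in the quotient `ℤ / p^k`
shows that each coset contains a vector of norm `≪ Q` (`exists_small_preimage`). Hence
`|(F + Θ)(x)| < δ Q^{-(n+1)}` is solvable with `‖a‖ ≪ Q`, even with the residues of `a_1, …, a_n`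
modulo `p²` prescribed; the residues are chosen so that the derivative of `F + Θ` is large
(`exists_small_linForm_add`), and a zero of `F + Θ` lies within `≪ Q^{-(n+1)}` of `x`.
-/

namespace PadicUbiquity

/-! ### Balls in `ℚ_p^m` and their volume -/

section Balls

variable {p : ℕ} [Fact p.Prime]

/-- An open ball of radius `r` in `ℚ_p` has a finite system of representatives modulo the open ball
of radius `s ≤ r`, whose size is comparable to `r / s`. -/
theorem exists_ball_representatives {r s : ℝ} (hs : 0 < s) (hsr : s ≤ r) :
    ∃ T : Finset ℚ_[p], (∀ v ∈ T, ‖v‖ < r) ∧ (∀ v : ℚ_[p], ‖v‖ < r → ∃ w ∈ T, ‖v - w‖ < s) ∧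
      (∀ v ∈ T, ∀ w ∈ T, v ≠ w → s ≤ ‖v - w‖) ∧ (T.card : ℝ) ≤ p * (r / s) ∧
      r / s ≤ p * T.card := by
  classical
  have hp : (1 : ℝ) < p := by exact_mod_cast (Fact.out : p.Prime).one_lt
  have hp0 : (0 : ℝ) < p := by linarith
  have hr : 0 < r := hs.trans_le hsr
  obtain ⟨a, ha⟩ := exists_mem_Ioc_zpow hr hp
  obtain ⟨b, hb⟩ := exists_mem_Ioc_zpow hs hp
  have hba : b ≤ a := by
    have h : (p : ℝ) ^ b < (p : ℝ) ^ (a + 1) := hb.1.trans_le (hsr.trans ha.2)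
    have := (zpow_lt_zpow_iff_right₀ hp).1 h
    omega
  obtain ⟨N, hN⟩ := Int.eq_ofNat_of_zero_le (sub_nonneg.2 hba)
  -- Open balls are closed balls whose radius is a power of `p`; the representatives below are
  -- `p^{-a} k` with `0 ≤ k < p^N`, where `N = a - b`.
  have norm_lt_iff : ∀ (x : ℚ_[p]) (c : ℤ) (R : ℝ), R ∈ Set.Ioc ((p : ℝ) ^ c) ((p : ℝ) ^ (c + 1)) →
      (‖x‖ < R ↔ ‖x‖ ≤ (p : ℝ) ^ c) := by
    intro x c R hR
    refine ⟨fun h => ?_, fun h => h.trans_lt hR.1⟩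
    have := (Padic.norm_le_pow_iff_norm_lt_pow_add_one x c).2 (h.trans_le hR.2)
    exact this
  have hpa : ‖(p : ℚ_[p]) ^ (-a)‖ = (p : ℝ) ^ a := by simp
  have hab : (p : ℝ) ^ a * (p : ℝ) ^ (-(N : ℤ)) = (p : ℝ) ^ b := by
    rw [← zpow_add₀ hp0.ne']; congr 1; omega
  have hinj : ∀ k < p ^ N, ∀ l < p ^ N,
      ‖(p : ℚ_[p]) ^ (-a) * (k : ℚ_[p]) - (p : ℚ_[p]) ^ (-a) * (l : ℚ_[p])‖ < s → k = l := by
    intro k hk l hl h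
    rw [norm_lt_iff _ _ _ hb, ← mul_sub, norm_mul, hpa, ← hab,
      mul_le_mul_iff_right₀ (zpow_pos hp0 _)] at h
    have h' : ‖(((k : ℤ) - (l : ℤ) : ℤ) : ℚ_[p])‖ ≤ (p : ℝ) ^ (-(N : ℤ)) := by
      push_cast; exact h
    rw [Padic.norm_int_le_pow_iff_dvd] at h'
    have h3 : (l : ℤ) ≡ k [ZMOD ((p ^ N : ℕ) : ℤ)] := by
      rw [Int.modEq_iff_dvd]; exact_mod_cast h'
    have h4 := (Int.natCast_modEq_iff.1 h3)
    exact (h4.eq_of_lt_of_lt hl hk).symm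
  have hcard : ((Finset.range (p ^ N)).image
      fun k : ℕ => (p : ℚ_[p]) ^ (-a) * (k : ℚ_[p])).card = p ^ N := by
    rw [Finset.card_image_of_injOn, Finset.card_range]
    intro k hk l hl h
    refine hinj k (by simpa using hk) l (by simpa using hl) ?_
    simp only at h
    rw [h, sub_self, norm_zero]
    exact hs
  refine ⟨(Finset.range (p ^ N)).image fun k : ℕ => (p : ℚ_[p]) ^ (-a) * (k : ℚ_[p]),
    ?_, ?_, ?_, ?_, ?_⟩
  · intro v hv
    obtain ⟨k, -, rfl⟩ := Finset.mem_image.1 hv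
    rw [norm_lt_iff _ _ _ ha, norm_mul, hpa]
    have : ‖(k : ℚ_[p])‖ ≤ 1 := by exact_mod_cast Padic.norm_int_le_one (p := p) (k : ℤ)
    nlinarith [zpow_pos hp0 a]
  · intro v hv
    rw [norm_lt_iff _ _ _ ha] at hv
    have hz : ‖(p : ℚ_[p]) ^ a * v‖ ≤ 1 := by
      rw [norm_mul, norm_zpow, Padic.norm_p, inv_zpow']
      calc (p : ℝ) ^ (-a) * ‖v‖ ≤ (p : ℝ) ^ (-a) * (p : ℝ) ^ a := by gcongr
        _ = 1 := by rw [← zpow_add₀ hp0.ne']; simp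
    set z : ℤ_[p] := ⟨(p : ℚ_[p]) ^ a * v, hz⟩ with hzdef
    refine ⟨_, Finset.mem_image.2 ⟨z.appr N, Finset.mem_range.2 (z.appr_lt N), rfl⟩, ?_⟩
    have h1 := ((z - z.appr N).norm_le_pow_iff_mem_span_pow N).2 (z.appr_spec N)
    have h2 : v - (p : ℚ_[p]) ^ (-a) * (z.appr N : ℚ_[p]) =
        (p : ℚ_[p]) ^ (-a) * ((z - z.appr N : ℤ_[p]) : ℚ_[p]) := by
      have hpne : (p : ℚ_[p]) ≠ 0 := by exact_mod_cast (Fact.out : p.Prime).ne_zero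
      rw [PadicInt.coe_sub, PadicInt.coe_natCast, hzdef, mul_sub, ← mul_assoc,
        ← zpow_add₀ hpne, neg_add_cancel, zpow_zero, one_mul]
    rw [norm_lt_iff _ _ _ hb, h2, norm_mul, hpa, ← hab]
    gcongr
    exact h1
  · intro v hv w hw hvw
    obtain ⟨k, hk, rfl⟩ := Finset.mem_image.1 hv
    obtain ⟨l, hl, rfl⟩ := Finset.mem_image.1 hw
    by_contra! h
    exact hvw (by rw [hinj k (by simpa using hk) l (by simpa using hl) h])
  · rw [hcard, mul_div_assoc', le_div_iff₀ hs]
    have : (p : ℝ) ^ N * (p : ℝ) ^ (b + 1) = p * (p : ℝ) ^ a := by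
      rw [← zpow_natCast, ← zpow_add₀ hp0.ne', ← zpow_one_add₀ hp0.ne']; congr 1; omega
    push_cast
    calc (p : ℝ) ^ N * s ≤ (p : ℝ) ^ N * (p : ℝ) ^ (b + 1) := by gcongr; exact hb.2
      _ = p * (p : ℝ) ^ a := this
      _ ≤ p * r := by gcongr; exact ha.1.le
  · rw [hcard, div_le_iff₀ hs]
    have : (p : ℝ) * (p : ℝ) ^ N * (p : ℝ) ^ b = (p : ℝ) ^ (a + 1) := by
      rw [← zpow_natCast, ← zpow_one_add₀ hp0.ne', ← zpow_add₀ hp0.ne']; congr 1; omega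
    push_cast
    calc r ≤ (p : ℝ) ^ (a + 1) := ha.2
      _ = (p : ℝ) * (p : ℝ) ^ N * (p : ℝ) ^ b := this.symm
      _ ≤ _ := by gcongr; exact hb.1.le

/-- The volumes of two concentric balls of `ℚ_p` differ by the index of one in the other. -/
theorem volume_ball_eq_card_mul {r s : ℝ} (hs : 0 < s) (hsr : s ≤ r) :
    ∃ N : ℕ, volume (Metric.ball (0 : ℚ_[p]) r) = N * volume (Metric.ball (0 : ℚ_[p]) s) ∧
      (N : ℝ) ≤ p * (r / s) ∧ r / s ≤ p * N := by
  obtain ⟨T, h1, h2, h3, h4, h5⟩ := exists_ball_representatives (p := p) hs hsr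
  refine ⟨T.card, ?_, h4, h5⟩
  have hU : Metric.ball (0 : ℚ_[p]) r = ⋃ v ∈ T, Metric.ball v s := by
    ext x
    simp only [Set.mem_iUnion, Metric.mem_ball, dist_eq_norm, exists_prop, sub_zero]
    refine ⟨h2 x, ?_⟩
    rintro ⟨w, hw, hx⟩
    have := IsUltrametricDist.norm_add_le_max (x - w) w
    rw [sub_add_cancel] at this
    exact this.trans_lt (max_lt (hx.trans_le hsr) (h1 w hw))
  rw [hU, measure_biUnion_finset _ fun _ _ => measurableSet_ball]
  · rw [Finset.sum_congr rfl fun v _ => Measure.addHaar_ball_center volume v s]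
    simp
  · intro v hv w hw hvw
    rcases IsUltrametricDist.ball_eq_or_disjoint v w s with h | h
    · have : v ∈ Metric.ball w s := h ▸ Metric.mem_ball_self hs
      exact absurd (h3 v hv w hw hvw) (not_le.2 (by rwa [Metric.mem_ball, dist_eq_norm] at this))
    · exact h

theorem volume_ball_prime : volume (Metric.ball (0 : ℚ_[p]) p) = 1 := by
  have : Metric.ball (0 : ℚ_[p]) p = (unitBall p : Set ℚ_[p]) := by
    ext x
    have := Padic.norm_le_pow_iff_norm_lt_pow_add_one x 0
    simp only [zpow_zero, zero_add, zpow_one] at this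
    rw [mem_ball_zero_iff, ← this]
    exact mem_closedBall_zero_iff.symm
  rw [this]
  exact Measure.addHaarMeasure_self

theorem volume_ball_bounds {r : ℝ} (hr : 0 < r) :
    ENNReal.ofReal (r / p ^ 2) ≤ volume (Metric.ball (0 : ℚ_[p]) r) ∧
      volume (Metric.ball (0 : ℚ_[p]) r) ≤ ENNReal.ofReal r := by
  have hp0 : (0 : ℝ) < p := by exact_mod_cast (Fact.out : p.Prime).pos
  rcases le_total (p : ℝ) r with h | h
  · obtain ⟨N, hN, h1, h2⟩ := volume_ball_eq_card_mul (p := p) hp0 h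
    rw [hN, volume_ball_prime, mul_one, ← ENNReal.ofReal_natCast]
    refine ⟨ENNReal.ofReal_le_ofReal ?_, ENNReal.ofReal_le_ofReal ?_⟩
    · rw [div_le_iff₀ (by positivity)] at h2 ⊢; linarith
    · rwa [mul_div_cancel₀ _ hp0.ne'] at h1
  · obtain ⟨N, hN, h1, h2⟩ := volume_ball_eq_card_mul (p := p) hr h
    have hN0 : (0 : ℝ) < N := by
      have : 0 < (p : ℝ) * N := (by positivity : 0 < (p : ℝ) / r).trans_le h2
      exact pos_of_mul_pos_right this hp0.le
    have hv : volume (Metric.ball (0 : ℚ_[p]) r) = ENNReal.ofReal (N : ℝ)⁻¹ := by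
      rw [ENNReal.ofReal_inv_of_pos hN0, ENNReal.ofReal_natCast]
      refine ENNReal.eq_inv_of_mul_eq_one_left ?_
      rw [mul_comm, ← hN, volume_ball_prime]
    rw [hv]
    refine ⟨ENNReal.ofReal_le_ofReal ?_, ENNReal.ofReal_le_ofReal ?_⟩
    · rw [div_le_iff₀ (by positivity), ← div_eq_inv_mul, le_div_iff₀ hN0]
      rw [mul_div_assoc', le_div_iff₀ hr] at h1
      linarith
    · rw [div_le_iff₀ hr] at h2
      rw [inv_le_iff_one_le_mul₀ hN0]
      have : (p : ℝ) * 1 ≤ p * (r * N) := by linarith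
      exact le_of_mul_le_mul_left this hp0

variable {m : ℕ}

theorem volume_pi_ball_bounds (x : Fin m → ℚ_[p]) {r : ℝ} (hr : 0 < r) :
    ENNReal.ofReal ((r / p ^ 2) ^ m) ≤ volume (Metric.ball x r) ∧
      volume (Metric.ball x r) ≤ ENNReal.ofReal (r ^ m) := by
  rw [volume_pi_ball x hr, Finset.prod_congr rfl fun i _ =>
    Measure.addHaar_ball_center volume (x i) r, Finset.prod_const, Finset.card_univ,
    Fintype.card_fin, ENNReal.ofReal_pow (by positivity), ENNReal.ofReal_pow hr.le]
  have := volume_ball_bounds (p := p) hr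
  exact ⟨pow_le_pow_left' this.1 m, pow_le_pow_left' this.2 m⟩

theorem volume_preimage_add_left (v : Fin m → ℚ_[p]) (A : Set (Fin m → ℚ_[p])) :
    volume ((fun x => v + x) ⁻¹' A) = volume A := by
  have : (volume : Measure (Fin m → ℚ_[p])).IsAddLeftInvariant :=
    Measure.pi.isAddLeftInvariant (fun _ => volume)
  exact measure_preimage_add volume v A

/-- If every line in direction `e_j` meets `A` in a set of diameter less than `μ`, then the part of
a ball taken up by `A` has relative volume at most a constant times `μ / r`: translates of `A` by
multiples of `e_j` representing the ball modulo `μ` are disjoint. -/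
theorem volume_le_of_small_fibers (j : Fin m) {A : Set (Fin m → ℚ_[p])} (hA : MeasurableSet A)
    {y : Fin m → ℚ_[p]} {r μ : ℝ} (hμ : 0 < μ) (hμr : μ ≤ r) (hAy : A ⊆ Metric.ball y r)
    (hfib : ∀ x ∈ A, ∀ v : ℚ_[p], x + Pi.single j v ∈ A → ‖v‖ < μ) :
    volume A ≤ ENNReal.ofReal (p * (μ / r)) * volume (Metric.ball y r) := by
  have hp0 : (0 : ℝ) < p := by exact_mod_cast (Fact.out : p.Prime).pos
  have hr : 0 < r := hμ.trans_le hμr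
  obtain ⟨T, h1, -, h3, -, h5⟩ := exists_ball_representatives (p := p) hμ hμr
  have hle : (T.card : ENNReal) * volume A ≤ volume (Metric.ball y r) := by
    have hdisj : (T : Set ℚ_[p]).PairwiseDisjoint
        fun v => (fun x => (Pi.single j v : Fin m → ℚ_[p]) + x) '' A := by
      intro v hv w hw hvw
      refine Set.disjoint_left.2 ?_
      rintro _ ⟨x, hx, rfl⟩ ⟨x', hx', hxx⟩
      refine absurd (h3 v hv w hw hvw) (not_le.2 (hfib x hx (v - w) ?_))
      have : x' = x + Pi.single j (v - w) := by
        rw [Pi.single_sub]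
        simp only at hxx
        rw [eq_sub_of_add_eq' hxx]; abel
      exact this ▸ hx'
    have hmeas : ∀ v ∈ T, MeasurableSet ((fun x => (Pi.single j v : Fin m → ℚ_[p]) + x) '' A) :=
      fun v _ =>
      (MeasurableEquiv.addLeft (Pi.single j v : Fin m → ℚ_[p])).measurableSet_image.2 hA
    calc (T.card : ENNReal) * volume A
        = ∑ v ∈ T, volume ((fun x => (Pi.single j v : Fin m → ℚ_[p]) + x) '' A) := by
          rw [Finset.sum_congr rfl fun v _ => ?_, Finset.sum_const, nsmul_eq_mul]
          rw [Set.image_add_left, volume_preimage_add_left]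
      _ = volume (⋃ v ∈ T, (fun x => (Pi.single j v : Fin m → ℚ_[p]) + x) '' A) :=
          (measure_biUnion_finset hdisj hmeas).symm
      _ ≤ volume (Metric.ball y r) := by
          refine measure_mono (Set.iUnion₂_subset fun v hv => ?_)
          rintro _ ⟨x, hx, rfl⟩
          have hxy := hAy hx
          rw [Metric.mem_ball, dist_eq_norm] at hxy ⊢
          have h := IsUltrametricDist.norm_add_le_max (Pi.single j v : Fin m → ℚ_[p]) (x - y)
          rw [← add_sub_assoc, Pi.norm_single] at h
          exact h.trans_lt (max_lt (h1 v hv) hxy)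
  have hone : (1 : ENNReal) ≤ ENNReal.ofReal (p * (μ / r)) * T.card := by
    rw [← ENNReal.ofReal_natCast, ← ENNReal.ofReal_mul (by positivity), ← ENNReal.ofReal_one]
    refine ENNReal.ofReal_le_ofReal ?_
    rw [div_le_iff₀ hμ] at h5
    rw [mul_div_assoc', div_mul_eq_mul_div, le_div_iff₀ hr]
    linarith
  calc volume A ≤ (ENNReal.ofReal (p * (μ / r)) * T.card) * volume A := le_mul_of_one_le_left' hone
    _ = ENNReal.ofReal (p * (μ / r)) * (T.card * volume A) := mul_assoc _ _ _
    _ ≤ _ := by gcongr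

/-- If from every point of `E` a shift by less than `r` in direction `e_j` leads to a segment of
length `μ` of `A`, then `E` is covered by boundedly many times `r / μ` translates of `A`. -/
theorem volume_le_of_large_fibers (j : Fin m) {A E : Set (Fin m → ℚ_[p])} {r μ : ℝ} (hμ : 0 < μ)
    (hμr : μ ≤ r)
    (hfib : ∀ x ∈ E, ∃ v : ℚ_[p], ‖v‖ < r ∧ ∀ u : ℚ_[p], ‖u - v‖ < μ → x + Pi.single j u ∈ A) :
    volume E ≤ ENNReal.ofReal (p * (r / μ)) * volume A := by
  obtain ⟨T, -, h2, -, h4, -⟩ := exists_ball_representatives (p := p) hμ hμr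
  have hE : E ⊆ ⋃ v ∈ T, (fun x => (Pi.single j v : Fin m → ℚ_[p]) + x) ⁻¹' A := by
    intro x hx
    obtain ⟨v, hv, hA⟩ := hfib x hx
    obtain ⟨w, hw, hvw⟩ := h2 v hv
    refine Set.mem_iUnion₂.2 ⟨w, hw, ?_⟩
    rw [Set.mem_preimage, add_comm]
    exact hA w (by rwa [norm_sub_rev])
  calc volume E ≤ ∑ v ∈ T, volume ((fun x => (Pi.single j v : Fin m → ℚ_[p]) + x) ⁻¹' A) :=
        (measure_mono hE).trans (measure_biUnion_finset_le _ _)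
    _ = T.card * volume A := by
        simp
    _ ≤ _ := by
        gcongr
        rw [← ENNReal.ofReal_natCast]
        exact ENNReal.ofReal_le_ofReal h4

end Balls

/-! ### Covering a finite group by the image of a box -/

section Lattice

/-- Let a homomorphism from `ℤ^d` onto a finite group `G` be such that no nonzero vector of height
at most `L` lies in its kernel. Boxes of height `L` then have many distinct values, so that a box
whose height is a bounded multiple of `L` (depending on `|G| / L^d`) takes every value. This
replaces the bound for the last minimum of the kernel that Minkowski's second theorem gives. With
`S j` the set of values on the box of height `j L`: as long as `S (j + 1)` is not everything, there
is `h ∈ S (j + 2)` outside `S (j + 1)`, and `h + S 1 ⊆ S (j + 3)` is disjoint from `S j`. -/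
theorem exists_small_preimage {d : ℕ} {G : Type*} [AddCommGroup G] [Finite G]
    (φ : (Fin d → ℤ) →+ G) (hφ : Function.Surjective φ) {L K : ℕ} (hL : 1 ≤ L)
    (hinj : ∀ a : Fin d → ℤ, (∀ i, |a i| ≤ L) → φ a = 0 → a = 0)
    (hcard : Nat.card G < K * (L + 1) ^ d) (g : G) :
    ∃ a : Fin d → ℤ, (∀ i, |a i| ≤ (3 * K * L : ℕ)) ∧ φ a = g := by
  set S : ℕ → Set G := fun j => φ '' {a | ∀ i, |a i| ≤ (j * L : ℕ)} with hS
  have mem_S : ∀ {j : ℕ} {a : Fin d → ℤ}, (∀ i, |a i| ≤ (j * L : ℕ)) → φ a ∈ S j :=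
    fun h => ⟨_, h, rfl⟩
  have S_mono : ∀ {j k : ℕ}, j ≤ k → S j ⊆ S k := by
    rintro j k hjk _ ⟨a, ha, rfl⟩
    exact mem_S fun i => (ha i).trans (by exact_mod_cast Nat.mul_le_mul_right L hjk)
  have S_add : ∀ {j k : ℕ} {x y : G}, x ∈ S j → y ∈ S k → x + y ∈ S (j + k) := by
    rintro j k _ _ ⟨a, ha, rfl⟩ ⟨b, hb, rfl⟩
    rw [← map_add]
    refine mem_S fun i => (abs_add_le _ _).trans ?_
    rw [add_mul, Nat.cast_add]
    exact add_le_add (ha i) (hb i)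
  have S_split : ∀ {j : ℕ} {x : G}, x ∈ S (j + 1) → ∃ y ∈ S j, ∃ z ∈ S 1, x = y + z := by
    rintro j _ ⟨a, ha, rfl⟩
    refine ⟨φ fun i => max (-((j * L : ℕ) : ℤ)) (min (a i) (j * L : ℕ)), mem_S fun i => ?_,
      φ (a - fun i => max (-((j * L : ℕ) : ℤ)) (min (a i) (j * L : ℕ))), mem_S fun i => ?_, ?_⟩
    · rw [abs_le]
      have : (0 : ℤ) ≤ (j * L : ℕ) := Int.natCast_nonneg _
      omega
    · have := abs_le.1 (ha i)
      rw [add_mul, Nat.cast_add] at this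
      rw [Pi.sub_apply, abs_le]
      have h0 : (0 : ℤ) ≤ (j * L : ℕ) := Int.natCast_nonneg _
      omega
    · rw [← map_add, add_sub_cancel]
  -- A box that gains no values when enlarged once gains none later, hence has all of them.
  have S_stable : ∀ {j : ℕ}, S (j + 1) ⊆ S j → S j = Set.univ := by
    intro j hj
    have hall : ∀ k, S (j + k) ⊆ S j := by
      intro k
      induction k with
      | zero => exact subset_rfl
      | succ k ih =>
        intro x hx
        obtain ⟨y, hy, z, hz, rfl⟩ := S_split (j := j + k) hx
        exact hj (S_add (ih hy) hz)
    refine Set.eq_univ_of_forall fun x => ?_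
    obtain ⟨a, rfl⟩ := hφ x
    refine hall (∑ i, (a i).natAbs) (mem_S fun i => ?_)
    have h1 : (a i).natAbs ≤ ∑ i, (a i).natAbs :=
      Finset.single_le_sum (f := fun i => (a i).natAbs) (fun _ _ => Nat.zero_le _)
        (Finset.mem_univ i)
    have h2 : (a i).natAbs ≤ (j + ∑ i, (a i).natAbs) * L :=
      (h1.trans (Nat.le_add_left _ j)).trans (Nat.le_mul_of_pos_right _ hL)
    rw [Int.abs_eq_natAbs]
    exact_mod_cast h2
  have hcardS1 : (L + 1) ^ d ≤ (S 1).ncard := by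
    set ψ : (Fin d → Fin (L + 1)) → G := fun b => φ fun i => ((b i : ℕ) : ℤ) with hψ
    have hψinj : Function.Injective ψ := by
      intro b b' h
      have hz := hinj ((fun i => ((b i : ℕ) : ℤ)) - fun i => ((b' i : ℕ) : ℤ)) (fun i => by
        have := (b i).isLt
        have := (b' i).isLt
        rw [Pi.sub_apply, abs_le]
        omega) (by rw [map_sub, sub_eq_zero]; exact h)
      ext i
      have := congrFun hz i
      simp only [Pi.sub_apply, Pi.zero_apply] at this
      omega
    calc (L + 1) ^ d = (Set.range ψ).ncard := by
          rw [← Set.image_univ, Set.ncard_image_of_injective _ hψinj, Set.ncard_univ]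
          simp
      _ ≤ (S 1).ncard := by
          refine Set.ncard_le_ncard ?_ (Set.toFinite _)
          rintro _ ⟨b, rfl⟩
          refine mem_S fun i => ?_
          have := (b i).isLt
          rw [one_mul, abs_le]
          omega
  have step : ∀ j : ℕ, S (j + 1) ≠ Set.univ → (S j).ncard + (L + 1) ^ d ≤ (S (j + 3)).ncard := by
    intro j hj
    obtain ⟨h, hh, hh'⟩ := Set.not_subset.1 (mt S_stable hj)
    have hdisj : Disjoint (S j) ((fun x => h + x) '' S 1) := by
      refine Set.disjoint_left.2 ?_
      rintro _ hx ⟨_, ⟨a, ha, rfl⟩, rfl⟩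
      refine hh' ?_
      have hneg : φ (-a) ∈ S 1 := mem_S fun i => by rw [Pi.neg_apply, abs_neg]; exact ha i
      have := S_add hx hneg
      rwa [map_neg, add_neg_cancel_right] at this
    calc (S j).ncard + (L + 1) ^ d ≤ (S j).ncard + ((fun x => h + x) '' S 1).ncard := by
          rw [Set.ncard_image_of_injective _ (add_right_injective h)]
          gcongr
      _ = (S j ∪ (fun x => h + x) '' S 1).ncard :=
          (Set.ncard_union_eq hdisj (Set.toFinite _) (Set.toFinite _)).symm
      _ ≤ (S (j + 3)).ncard := by
          refine Set.ncard_le_ncard (Set.union_subset (S_mono (by omega)) ?_) (Set.toFinite _)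
          rintro _ ⟨x, hx, rfl⟩
          exact S_add (j := j + 2) (k := 1) hh hx
  have growth : ∀ i : ℕ, S (3 * i) ≠ Set.univ → i * (L + 1) ^ d ≤ (S (3 * i)).ncard := by
    have hne : ∀ {j k : ℕ}, j ≤ k → S k ≠ Set.univ → S j ≠ Set.univ := fun hjk hk hj =>
      hk (Set.univ_subset_iff.1 (hj ▸ S_mono hjk))
    intro i
    induction i with
    | zero => simp
    | succ i ih =>
      intro hi
      have h1 := ih (hne (by omega) hi)
      have h2 := step (3 * i) (hne (by omega) hi)
      rw [show 3 * (i + 1) = 3 * i + 3 by ring, add_mul, one_mul]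
      omega
  have huniv : S (3 * K) = Set.univ := by
    by_contra h
    have h1 := growth K h
    have h2 := Set.ncard_le_card (S (3 * K))
    omega
  have : g ∈ S (3 * K) := huniv ▸ Set.mem_univ g
  exact this

variable {p : ℕ} [Fact p.Prime] {n : ℕ}

theorem norm_le_inv_pow_iff_toZModPow (x : ℤ_[p]) (k : ℕ) :
    ‖x‖ ≤ ((p : ℝ) ^ k)⁻¹ ↔ PadicInt.toZModPow k x = 0 := by
  rw [← RingHom.mem_ker, PadicInt.ker_toZModPow, ← PadicInt.norm_le_pow_iff_mem_span_pow,
    zpow_neg, zpow_natCast]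

/-- Inhomogeneous approximation: if `a_0 + ∑ a_i F_i` is never smaller than `δ Q^{-(n+1)}` for
`‖a‖ ≤ Q`, then every `-θ` is approximated that well by some `a_0 + ∑ a_i F_i` with `‖a‖ ≪ Q`, and
the residues of `a_1, …, a_n` modulo `p²` can be prescribed. -/
theorem exists_inhomogeneous_approximation (F : Fin n → ℤ_[p]) (θ : ℤ_[p]) {Q δ : ℝ} (hQ : 1 ≤ Q)
    (hδ : 0 < δ) (hδ1 : δ < 1)
    (hlarge : ∀ a : Fin (n + 1) → ℤ, (∃ i : Fin n, a i.succ ≠ 0) → ‖a‖ ≤ Q →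
      δ * (Q ^ (n + 1))⁻¹ ≤ ‖(a 0 : ℤ_[p]) + ∑ i : Fin n, (a i.succ : ℤ_[p]) * F i‖)
    (b : Fin n → ℤ) (hb : ∀ i, |b i| ≤ p ^ 2) :
    ∃ a : Fin (n + 1) → ℤ, ‖a‖ ≤ p ^ 2 * (3 * ⌈p / δ⌉₊ + 1) * Q ∧
      (∃ c : Fin n → ℤ, ∀ i, a i.succ = b i + p ^ 2 * c i) ∧
      ‖(a 0 : ℤ_[p]) + ∑ i : Fin n, (a i.succ : ℤ_[p]) * F i + θ‖ < δ * (Q ^ (n + 1))⁻¹ := by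
  have hp : (1 : ℝ) < p := by exact_mod_cast (Fact.out : p.Prime).one_lt
  have hp0 : (0 : ℝ) < p := by linarith
  have hQ0 : 0 < Q := by linarith
  have hQn : Q ≤ Q ^ (n + 1) := le_self_pow₀ hQ (Nat.succ_ne_zero n)
  have hx1 : 1 < Q ^ (n + 1) / δ := by
    rw [lt_div_iff₀ hδ]; linarith
  obtain ⟨k', hk1, hk2⟩ := exists_nat_pow_near hx1.le hp
  set k := k' + 1 with hk
  have hkδ : ((p : ℝ) ^ k)⁻¹ < δ * (Q ^ (n + 1))⁻¹ := by
    rw [← div_eq_mul_inv, ← inv_div]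
    exact inv_strictAnti₀ (by positivity) hk2
  set ev : (Fin (n + 1) → ℤ) →+ ℤ_[p] :=
    { toFun := fun a => (a 0 : ℤ_[p]) + ∑ i : Fin n, (a i.succ : ℤ_[p]) * F i
      map_zero' := by simp
      map_add' := fun a a' => by
        simp only [Pi.add_apply, Int.cast_add, add_mul, Finset.sum_add_distrib]; ring } with hev
  have ev_apply : ∀ a, ev a = (a 0 : ℤ_[p]) + ∑ i : Fin n, (a i.succ : ℤ_[p]) * F i :=
    fun _ => rfl
  set φ : (Fin (n + 1) → ℤ) →+ ZMod (p ^ k) :=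
    (PadicInt.toZModPow (p := p) k).toAddMonoidHom.comp ev with hφ
  have φ_apply : ∀ a, φ a = PadicInt.toZModPow k (ev a) := fun _ => rfl
  have : NeZero (p ^ k) := ⟨pow_ne_zero _ (Fact.out : p.Prime).ne_zero⟩
  have hsurj : Function.Surjective φ := by
    intro g
    obtain ⟨z, rfl⟩ := ZMod.intCast_surjective g
    refine ⟨Fin.cons z 0, ?_⟩
    simp [φ_apply, ev_apply]
  have hL : (⌊Q⌋₊ : ℝ) ≤ Q := Nat.floor_le hQ0.le
  have hnorm : ∀ (a : Fin (n + 1) → ℤ) (R : ℝ), 0 ≤ R → (∀ i, (|a i| : ℝ) ≤ R) → ‖a‖ ≤ R :=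
    fun a R hR h => (pi_norm_le_iff_of_nonneg hR).2 fun i => by rw [Int.norm_eq_abs]; exact h i
  have hinj : ∀ a : Fin (n + 1) → ℤ, (∀ i, |a i| ≤ (⌊Q⌋₊ : ℤ)) → φ a = 0 → a = 0 := by
    intro a ha h0
    have haQ : ‖a‖ ≤ Q := hnorm a Q hQ0.le fun i => by
      refine le_trans ?_ hL
      exact_mod_cast ha i
    by_cases hex : ∃ i : Fin n, a i.succ ≠ 0
    · have h1 := (norm_le_inv_pow_iff_toZModPow (ev a) k).2 h0
      exact absurd (hlarge a hex haQ) (not_le.2 (h1.trans_lt hkδ))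
    · push Not at hex
      have h2 : ((a 0 : ℤ) : ZMod (p ^ k)) = 0 := by
        have := h0
        simpa [φ_apply, ev_apply, hex] using this
      rw [ZMod.intCast_zmod_eq_zero_iff_dvd] at h2
      have h3 : |a 0| < ((p ^ k : ℕ) : ℤ) := by
        have h4 : (⌊Q⌋₊ : ℝ) < (p : ℝ) ^ k := by
          refine lt_of_le_of_lt ?_ hk2
          rw [le_div_iff₀ hδ]
          nlinarith
        exact (ha 0).trans_lt (by exact_mod_cast h4)
      funext i
      refine Fin.cases ?_ (fun i => hex i) i
      exact Int.eq_zero_of_abs_lt_dvd h2 h3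
  have hcard : Nat.card (ZMod (p ^ k)) < ⌈p / δ⌉₊ * (⌊Q⌋₊ + 1) ^ (n + 1) := by
    rw [Nat.card_zmod]
    have h1 : (p : ℝ) ^ k < ⌈p / δ⌉₊ * (⌊Q⌋₊ + 1) ^ (n + 1) :=
      calc (p : ℝ) ^ k = p ^ k' * p := pow_succ _ _
        _ ≤ Q ^ (n + 1) / δ * p := by gcongr
        _ = p / δ * Q ^ (n + 1) := by ring
        _ < p / δ * (⌊Q⌋₊ + 1) ^ (n + 1) := by
          gcongr
          exact Nat.lt_floor_add_one Q
        _ ≤ _ := by gcongr; exact Nat.le_ceil _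
    exact_mod_cast h1
  -- The coefficient vector is `(r, b) + p² c`, where `r ∈ [0, p²)` makes the value at `(r, b)`
  -- divisible by `p²` and `c` is a small vector solving the congruence that remains modulo `p^k`.
  set e : ℤ_[p] := ∑ i, (b i : ℤ_[p]) * F i + θ with he
  obtain ⟨u, hu⟩ := Ideal.mem_span_singleton.1 (PadicInt.appr_spec 2 (-e))
  obtain ⟨c, hc, hcu⟩ := exists_small_preimage φ hsurj (Nat.le_floor (by simpa using hQ)) hinj hcard
    (PadicInt.toZModPow k u)
  set a : Fin (n + 1) → ℤ :=
    (Fin.cons ((-e).appr 2 : ℤ) b : Fin (n + 1) → ℤ) + fun i => p ^ 2 * c i with ha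
  have heva : ev a + θ = (p : ℤ_[p]) ^ 2 * (ev c - u) := by
    have : ev a = (-e).appr 2 + ∑ i, (b i : ℤ_[p]) * F i + p ^ 2 * ev c := by
      simp only [ev_apply, ha, Pi.add_apply, Fin.cons_zero, Fin.cons_succ, Int.cast_add,
        Int.cast_mul, Int.cast_pow, Int.cast_natCast, add_mul, Finset.sum_add_distrib, mul_add,
        Finset.mul_sum, mul_assoc]
      ring
    rw [this, mul_sub, ← hu]
    simp only [he]; ring
  refine ⟨a, hnorm a _ (by positivity) fun i => ?_, ⟨fun i => c i.succ, fun i => by simp [ha]⟩, ?_⟩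
  · have h1 : |(Fin.cons ((-e).appr 2 : ℤ) b : Fin (n + 1) → ℤ) i| ≤ p ^ 2 := by
      refine Fin.cases ?_ (fun i => ?_) i
      · rw [Fin.cons_zero, Nat.abs_cast]
        exact_mod_cast (PadicInt.appr_lt (-e) 2).le
      · rw [Fin.cons_succ]; exact hb i
    have h2 : |a i| ≤ p ^ 2 + p ^ 2 * (3 * ⌈p / δ⌉₊ * ⌊Q⌋₊ : ℕ) := by
      refine (abs_add_le _ _).trans (add_le_add h1 ?_)
      rw [abs_mul, abs_of_nonneg (by positivity : (0 : ℤ) ≤ p ^ 2)]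
      gcongr
      exact hc i
    have h3 : (|a i| : ℝ) ≤ p ^ 2 + p ^ 2 * (3 * ⌈p / δ⌉₊ * ⌊Q⌋₊) := by exact_mod_cast h2
    calc (|a i| : ℝ) ≤ p ^ 2 * 1 + p ^ 2 * (3 * ⌈p / δ⌉₊ * ⌊Q⌋₊) := by rwa [mul_one]
      _ ≤ p ^ 2 * Q + p ^ 2 * (3 * ⌈p / δ⌉₊ * Q) := by gcongr
      _ = _ := by ring
  · rw [← ev_apply, heva, norm_mul]
    have h1 : ‖ev c - u‖ ≤ ((p : ℝ) ^ k)⁻¹ := by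
      rw [norm_le_inv_pow_iff_toZModPow, map_sub, ← φ_apply, hcu, sub_self]
    calc ‖(p : ℤ_[p]) ^ 2‖ * ‖ev c - u‖ ≤ 1 * ((p : ℝ) ^ k)⁻¹ := by
          gcongr
          exact PadicInt.norm_le_one _
      _ < _ := by rwa [one_mul]

end Lattice

/-! ### Zero sets of functions that expand distances along a coordinate -/

section ZeroSets

variable {p : ℕ} [Fact p.Prime] {m : ℕ}

/-- `G` is Lipschitz on the ball `B(x₀, r₀)`, expands distances along the `j`-th coordinate by at
least `η`, and near every point of the ball where it is small it has a zero that differs from the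
point only in the `j`-th coordinate. -/
structure RegularAlong (j : Fin m) (x₀ : Fin m → ℚ_[p]) (r₀ : ℝ) (G : (Fin m → ℚ_[p]) → ℚ_[p])
    (η M : ℝ) : Prop where
  lipschitz : ∀ y ∈ Metric.ball x₀ r₀, ∀ z ∈ Metric.ball x₀ r₀, ‖G y - G z‖ ≤ M * ‖y - z‖
  expanding : ∀ y ∈ Metric.ball x₀ r₀, ∀ v : ℚ_[p], y + Pi.single j v ∈ Metric.ball x₀ r₀ →
    η * ‖v‖ ≤ ‖G (y + Pi.single j v) - G y‖
  exists_zero : ∀ y ∈ Metric.ball x₀ r₀, ‖G y‖ < η * r₀ → ∃ v : ℚ_[p], η * ‖v‖ ≤ ‖G y‖ ∧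
    y + Pi.single j v ∈ Metric.ball x₀ r₀ ∧ G (y + Pi.single j v) = 0

theorem add_single_mem_ball {j : Fin m} {x₀ y : Fin m → ℚ_[p]} {r : ℝ} {v : ℚ_[p]}
    (hy : y ∈ Metric.ball x₀ r) (hv : ‖v‖ < r) : y + Pi.single j v ∈ Metric.ball x₀ r := by
  rw [Metric.mem_ball, dist_eq_norm] at hy ⊢
  have h := IsUltrametricDist.norm_add_le_max (Pi.single j v : Fin m → ℚ_[p]) (y - x₀)
  rw [Pi.norm_single, ← add_sub_assoc, add_comm _ y] at h
  exact h.trans_lt (max_lt hv hy)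

/-- A function whose increments along the `j`-th coordinate are those of multiplication by `D`, up
to a relative error of at most one half, is regular along that coordinate; the zeros come from the
Newton iteration behind the inverse function theorem. -/
theorem regularAlong_of_approximates {j : Fin m} {x₀ : Fin m → ℚ_[p]} {r₀ : ℝ}
    {G : (Fin m → ℚ_[p]) → ℚ_[p]} {η M : ℝ} {D : ℚ_[p]} (hη : 0 < η) (hD : 2 * η ≤ ‖D‖)
    (hlip : ∀ y ∈ Metric.ball x₀ r₀, ∀ z ∈ Metric.ball x₀ r₀, ‖G y - G z‖ ≤ M * ‖y - z‖)
    (happrox : ∀ y ∈ Metric.ball x₀ r₀, ∀ v w : ℚ_[p], ‖v‖ < r₀ → ‖w‖ < r₀ →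
      ‖G (y + Pi.single j v) - G (y + Pi.single j w) - D * (v - w)‖ ≤ η * ‖v - w‖) :
    RegularAlong j x₀ r₀ G η M := by
  have hD0 : 0 < ‖D‖ := by linarith
  refine ⟨hlip, fun y hy v hv => ?_, fun y hy hsmall => ?_⟩
  · have hr₀ : 0 < r₀ := dist_nonneg.trans_lt (Metric.mem_ball.1 hy)
    have hvr : ‖v‖ < r₀ := by
      rw [IsUltrametricDist.ball_eq_of_mem hy] at hv
      rwa [Metric.mem_ball, dist_eq_norm, add_sub_cancel_left, Pi.norm_single] at hv
    have h := happrox y hy v 0 hvr (by rwa [norm_zero])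
    rw [Pi.single_zero, add_zero, sub_zero] at h
    have h1 : ‖D * v‖ ≤ ‖G (y + Pi.single j v) - G y‖ + η * ‖v‖ := by
      have := norm_sub_norm_le (D * v) (G (y + Pi.single j v) - G y)
      rw [norm_sub_rev (D * v)] at this
      linarith
    rw [norm_mul] at h1
    nlinarith [norm_nonneg v]
  · set ε : ℝ := ‖G y‖ / η with hε
    have hε0 : 0 ≤ ε := by positivity
    have hεr : ε < r₀ := by rw [hε, div_lt_iff₀ hη]; linarith
    have hAL : ApproximatesLinearOn (fun v : ℚ_[p] => G (y + Pi.single j v))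
        (ContinuousLinearMap.toSpanSingleton ℚ_[p] D) (Metric.ball (0 : ℚ_[p]) r₀)
        (NNReal.mk η hη.le) := by
      intro v hv w hw
      have := happrox y hy v w (mem_ball_zero_iff.1 hv) (mem_ball_zero_iff.1 hw)
      rw [NNReal.coe_mk]
      simpa [mul_comm D] using this
    let inv : (ContinuousLinearMap.toSpanSingleton ℚ_[p] D).NonlinearRightInverse :=
      { toFun := fun u => D⁻¹ * u
        nnnorm := ‖D‖₊⁻¹
        bound' := fun u => by simp
        right_inv' := fun u => by
          have : D ≠ 0 := norm_pos_iff.1 hD0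
          simp [mul_comm, this] }
    have hsurj := hAL.surjOn_closedBall_of_nonlinearRightInverse inv hε0
      (Metric.closedBall_subset_ball hεr)
    have h0 : (0 : ℚ_[p]) ∈ Metric.closedBall (G (y + Pi.single j 0))
        (((inv.nnnorm : ℝ)⁻¹ - NNReal.mk η hη.le) * ε) := by
      rw [Pi.single_zero, add_zero, mem_closedBall_iff_norm', sub_zero]
      have : ((inv.nnnorm : ℝ)⁻¹ - NNReal.mk η hη.le) = ‖D‖ - η := by simp [inv]
      rw [this]
      calc ‖G y‖ = η * ε := by rw [hε]; field_simp
        _ ≤ _ := by gcongr; linarith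
    obtain ⟨v, hv, hGv⟩ := hsurj h0
    rw [mem_closedBall_zero_iff] at hv
    refine ⟨v, ?_, add_single_mem_ball hy (hv.trans_lt hεr), hGv⟩
    calc η * ‖v‖ ≤ η * ε := by gcongr
      _ = ‖G y‖ := by rw [hε]; field_simp

theorem rpow_dim_sub_one (hm : 0 < m) {x : ℝ} : x ^ ((m : ℝ) - 1) = x ^ (m - 1) := by
  rw [← Real.rpow_natCast, Nat.cast_sub hm, Nat.cast_one]

namespace RegularAlong

variable {j : Fin m} {x₀ : Fin m → ℚ_[p]} {r₀ : ℝ} {G : (Fin m → ℚ_[p]) → ℚ_[p]} {η M : ℝ}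

/-- The neighbourhood of the zero set fills at least the expected part of a ball centred at a
zero. -/
theorem le_volume_inter_nbhd (h : RegularAlong j x₀ r₀ G η M) (hη : 0 < η) (hM : 0 ≤ M)
    {c : Fin m → ℚ_[p]} (hc : c ∈ Metric.ball x₀ r₀) (hGc : G c = 0) {l ρ : ℝ} (hl : 0 < l)
    (hlρ : l ≤ ρ) (hρ : ρ ≤ r₀) :
    ENNReal.ofReal ((1 / (2 * (M / η + 1)) / p ^ 2) ^ m / p) * volume (Metric.ball c l) *
        ENNReal.ofReal ((ρ / l) ^ ((m : ℝ) - 1)) ≤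
      volume (Metric.ball c (1 / 2 * ρ) ∩
        nbhd (Metric.ball x₀ r₀) {x ∈ Metric.ball x₀ r₀ | G x = 0} l) := by
  have hp0 : (0 : ℝ) < p := by exact_mod_cast (Fact.out : p.Prime).pos
  have hρ0 : 0 < ρ := hl.trans_le hlρ
  have hr₀ : 0 < r₀ := hρ0.trans_le hρ
  set k : ℝ := M / η with hk
  have hk0 : 0 ≤ k := by positivity
  -- Zeros found from points of `B(c, τ)` stay in `B(c, ρ / 2)`.
  set τ : ℝ := ρ * (1 / (2 * (k + 1))) with hτ
  have hτ0 : 0 < τ := by positivity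
  have hkτ : k * τ + τ = 1 / 2 * ρ := by rw [hτ]; field_simp
  have hMk : M = η * k := by rw [hk]; field_simp
  set A := Metric.ball c (1 / 2 * ρ) ∩
    nbhd (Metric.ball x₀ r₀) {x ∈ Metric.ball x₀ r₀ | G x = 0} l with hA
  have hfib : ∀ x ∈ Metric.ball c τ, ∃ v : ℚ_[p], ‖v‖ < 1 / 2 * ρ ∧
      ∀ u : ℚ_[p], ‖u - v‖ < 1 / 2 * l → x + Pi.single j u ∈ A := by
    intro x hx
    have hxρ : x ∈ Metric.ball c (1 / 2 * ρ) :=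
      Metric.ball_subset_ball (by nlinarith) hx
    have hx₀ : x ∈ Metric.ball x₀ r₀ := by
      rw [IsUltrametricDist.ball_eq_of_mem hc]
      exact Metric.ball_subset_ball (by linarith) hxρ
    have hGx : ‖G x‖ ≤ η * (k * τ) := by
      have h1 := h.lipschitz x hx₀ c hc
      rw [hGc, sub_zero, ← dist_eq_norm] at h1
      calc ‖G x‖ ≤ M * dist x c := h1
        _ ≤ M * τ := by gcongr; exact (Metric.mem_ball.1 hx).le
        _ = η * (k * τ) := by rw [hMk]; ring
    obtain ⟨v, hv, hvB, hGv⟩ := h.exists_zero x hx₀ (hGx.trans_lt (by gcongr; linarith))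
    have hvρ : ‖v‖ < 1 / 2 * ρ := by
      have : ‖v‖ ≤ k * τ := le_of_mul_le_mul_left (hv.trans hGx) hη
      linarith
    refine ⟨v, hvρ, fun u hu => ?_⟩
    have hu' : ‖u‖ < 1 / 2 * ρ := by
      have := IsUltrametricDist.norm_add_le_max (u - v) v
      rw [sub_add_cancel] at this
      exact this.trans_lt (max_lt (by linarith) hvρ)
    refine ⟨add_single_mem_ball hxρ hu', add_single_mem_ball hx₀ (by linarith), ?_⟩
    refine Metric.mem_thickening_iff.2 ⟨_, ⟨hvB, hGv⟩, ?_⟩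
    rw [dist_eq_norm, add_sub_add_left_eq_sub, ← Pi.single_sub, Pi.norm_single]
    linarith
  have hvol := volume_le_of_large_fibers j (by linarith : 0 < 1 / 2 * l) (by linarith) hfib
  have h1 := (volume_pi_ball_bounds c hτ0).1.trans hvol
  have hm : 0 < m := j.pos
  rw [rpow_dim_sub_one hm]
  calc ENNReal.ofReal ((1 / (2 * (k + 1)) / p ^ 2) ^ m / p) * volume (Metric.ball c l) *
        ENNReal.ofReal ((ρ / l) ^ (m - 1))
      ≤ ENNReal.ofReal ((1 / (2 * (k + 1)) / p ^ 2) ^ m / p) * ENNReal.ofReal (l ^ m) *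
        ENNReal.ofReal ((ρ / l) ^ (m - 1)) := by
        gcongr
        exact (volume_pi_ball_bounds c hl).2
    _ = ENNReal.ofReal (p * (ρ / l))⁻¹ * ENNReal.ofReal ((τ / p ^ 2) ^ m) := by
        rw [← ENNReal.ofReal_mul (by positivity), ← ENNReal.ofReal_mul (by positivity),
          ← ENNReal.ofReal_mul (by positivity)]
        congr 1
        obtain ⟨m', rfl⟩ := Nat.exists_eq_succ_of_ne_zero hm.ne'
        rw [hτ, Nat.succ_sub_one, mul_div_assoc ρ, mul_pow, div_pow ρ, pow_succ l, pow_succ ρ]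
        field_simp
    _ ≤ ENNReal.ofReal (p * (ρ / l))⁻¹ *
        (ENNReal.ofReal (p * (1 / 2 * ρ / (1 / 2 * l))) * volume A) := by gcongr
    _ = volume A := by
        rw [mul_div_mul_left _ _ (by norm_num : (1 / 2 : ℝ) ≠ 0), ← mul_assoc,
          ← ENNReal.ofReal_mul (by positivity), inv_mul_cancel₀ (by positivity),
          ENNReal.ofReal_one, one_mul]

/-- The neighbourhood of the zero set fills at most the expected part of any ball. -/
theorem volume_inter_nbhd_le (h : RegularAlong j x₀ r₀ G η M) (hη : 0 < η) (hM : 0 ≤ M)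
    (c y : Fin m → ℚ_[p]) {l r : ℝ} (hl : 0 < l) (hr : 0 < r) :
    volume (Metric.ball y r ∩
        nbhd (Metric.ball x₀ r₀) {x ∈ Metric.ball x₀ r₀ | G x = 0} (3 * l)) ≤
      ENNReal.ofReal ((p ^ 2) ^ m * p * (3 * (M / η) + 1)) * volume (Metric.ball c l) *
        ENNReal.ofReal ((r / l) ^ ((m : ℝ) - 1)) := by
  have hp1 : (1 : ℝ) ≤ p := by exact_mod_cast (Fact.out : p.Prime).one_lt.le
  have hp0 : (0 : ℝ) < p := by linarith
  set k : ℝ := M / η with hk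
  have hk0 : 0 ≤ k := by positivity
  have hMk : M = η * k := by rw [hk]; field_simp
  set μ : ℝ := (3 * k + 1) * l with hμ
  have hμ0 : 0 < μ := by positivity
  set A := Metric.ball y r ∩ (Metric.ball x₀ r₀ ∩ G ⁻¹' Metric.closedBall 0 (M * (3 * l))) with hA
  have hm : 0 < m := j.pos
  have hsub : Metric.ball y r ∩
      nbhd (Metric.ball x₀ r₀) {x ∈ Metric.ball x₀ r₀ | G x = 0} (3 * l) ⊆ A := by
    rintro x ⟨hxy, hx₀, hx⟩
    obtain ⟨z, ⟨hz, hGz⟩, hxz⟩ := Metric.mem_thickening_iff.1 hx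
    refine ⟨hxy, hx₀, mem_closedBall_zero_iff.2 ?_⟩
    have h1 := h.lipschitz x hx₀ z hz
    rw [hGz, sub_zero, ← dist_eq_norm] at h1
    exact h1.trans (by gcongr)
  have hcont : ContinuousOn G (Metric.ball x₀ r₀) := by
    refine (LipschitzOnWith.of_dist_le_mul (K := NNReal.mk M hM) fun y hy z hz => ?_).continuousOn
    rw [dist_eq_norm, dist_eq_norm]
    exact h.lipschitz y hy z hz
  have hmeas : MeasurableSet A := by
    refine measurableSet_ball.inter (IsClosed.measurableSet ?_)
    exact hcont.preimage_isClosed_of_isClosed (IsUltrametricDist.isClosed_ball _ _)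
      Metric.isClosed_closedBall
  have hfib : ∀ x ∈ A, ∀ v : ℚ_[p], x + Pi.single j v ∈ A → ‖v‖ < μ := by
    rintro x ⟨-, hx₀, hx⟩ v ⟨-, hv₀, hv⟩
    have h1 := h.expanding x hx₀ v hv₀
    rw [Set.mem_preimage, mem_closedBall_zero_iff] at hx hv
    have h2 := IsUltrametricDist.norm_add_le_max (G (x + Pi.single j v)) (-G x)
    rw [norm_neg, ← sub_eq_add_neg] at h2
    have h3 : η * ‖v‖ ≤ η * (3 * k * l) := by
      calc η * ‖v‖ ≤ M * (3 * l) := h1.trans (h2.trans (max_le hv hx))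
        _ = _ := by rw [hMk]; ring
    have h4 := le_of_mul_le_mul_left h3 hη
    rw [hμ]; linarith
  have hvolA : volume A ≤ ENNReal.ofReal (p * μ * r ^ (m - 1)) := by
    have hrm : r ^ m = r * r ^ (m - 1) := (mul_pow_sub_one hm.ne' r).symm
    rcases le_or_gt μ r with hμr | hμr
    · calc volume A ≤ ENNReal.ofReal (p * (μ / r)) * volume (Metric.ball y r) :=
            volume_le_of_small_fibers j hmeas hμ0 hμr Set.inter_subset_left hfib
        _ ≤ ENNReal.ofReal (p * (μ / r)) * ENNReal.ofReal (r ^ m) := by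
            gcongr
            exact (volume_pi_ball_bounds y hr).2
        _ = ENNReal.ofReal (p * μ * r ^ (m - 1)) := by
            rw [← ENNReal.ofReal_mul (by positivity), hrm]
            congr 1
            field_simp
    · calc volume A ≤ volume (Metric.ball y r) := measure_mono Set.inter_subset_left
        _ ≤ ENNReal.ofReal (r ^ m) := (volume_pi_ball_bounds y hr).2
        _ ≤ _ := by
            rw [hrm]
            refine ENNReal.ofReal_le_ofReal ?_
            gcongr
            nlinarith
  rw [rpow_dim_sub_one hm]
  calc _ ≤ volume A := measure_mono hsub
    _ ≤ ENNReal.ofReal (p * μ * r ^ (m - 1)) := hvolA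
    _ = ENNReal.ofReal ((p ^ 2) ^ m * p * (3 * k + 1)) * ENNReal.ofReal ((l / p ^ 2) ^ m) *
        ENNReal.ofReal ((r / l) ^ (m - 1)) := by
        rw [← ENNReal.ofReal_mul (by positivity), ← ENNReal.ofReal_mul (by positivity)]
        congr 1
        obtain ⟨m', rfl⟩ := Nat.exists_eq_succ_of_ne_zero hm.ne'
        rw [hμ, Nat.succ_sub_one, div_pow, div_pow, pow_succ l]
        field_simp
    _ ≤ _ := by
        gcongr
        exact (volume_pi_ball_bounds c hl).1

end RegularAlong

end ZeroSets

/-! ### Integer combinations of the coordinate functions -/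

section LinearForms

variable {p : ℕ} [Fact p.Prime] {m n : ℕ}

theorem norm_int_combination_add_le (a : Fin n → ℤ) {u : Fin n → ℚ_[p]} {w : ℚ_[p]} {b : ℝ}
    (hb : 0 ≤ b) (hu : ‖u‖ ≤ b) (hw : ‖w‖ ≤ b) : ‖∑ i, (a i : ℚ_[p]) * u i + w‖ ≤ b := by
  refine (IsUltrametricDist.norm_add_le_max _ _).trans (max_le ?_ hw)
  refine IsUltrametricDist.norm_sum_le_of_forall_le_of_nonneg hb fun i _ => ?_
  rw [norm_mul]
  calc ‖(a i : ℚ_[p])‖ * ‖u i‖ ≤ 1 * b := by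
        gcongr
        · exact Padic.norm_int_le_one _
        · exact (norm_le_pi_norm u i).trans hu
    _ = b := one_mul b

theorem AnalyticUpToBoundary.hasStrictFDerivAt {E : Type*} [NormedAddCommGroup E]
    [NormedSpace ℚ_[p] E] [CompleteSpace E] {U : Set (Fin m → ℚ_[p])} (hU : IsOpen U)
    {g : (Fin m → ℚ_[p]) → E} (hg : AnalyticUpToBoundary U g) {x : Fin m → ℚ_[p]} (hx : x ∈ U) :
    HasStrictFDerivAt g (fderiv ℚ_[p] g x) x := by
  obtain ⟨h, hh, hhg⟩ := hg
  have heq : h =ᶠ[𝓝 x] g := Filter.eventuallyEq_of_mem (hU.mem_nhds hx) hhg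
  exact ((hh x (subset_closure hx)).congr heq).hasStrictFDerivAt

/-- Since integers have `p`-adic absolute value at most `1`, one neighbourhood of `x₀` and one
Lipschitz constant serve all functions `a_0 + a_1 f_1 + ⋯ + a_n f_n + Θ` whose `j`-th partial
derivative at `x₀` is not smaller than that of `f`. -/
theorem exists_regularAlong {f : (Fin m → ℚ_[p]) → (Fin n → ℚ_[p])} {Θ : (Fin m → ℚ_[p]) → ℚ_[p]}
    {f' : (Fin m → ℚ_[p]) →L[ℚ_[p]] (Fin n → ℚ_[p])} {Θ' : (Fin m → ℚ_[p]) →L[ℚ_[p]] ℚ_[p]}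
    {x₀ : Fin m → ℚ_[p]} (hf : HasStrictFDerivAt f f' x₀) (hΘ : HasStrictFDerivAt Θ Θ' x₀)
    {j : Fin m} (hj : f' (Pi.single j 1) ≠ 0) :
    ∃ r₁ M : ℝ, 0 < r₁ ∧ 0 ≤ M ∧ ∀ r₀ ≤ r₁, ∀ a : Fin (n + 1) → ℤ,
      ‖f' (Pi.single j 1)‖ ≤
        ‖∑ i : Fin n, (a i.succ : ℚ_[p]) * f' (Pi.single j 1) i + Θ' (Pi.single j 1)‖ →
      RegularAlong j x₀ r₀ (fun x => linForm f a x + Θ x) (‖f' (Pi.single j 1)‖ / 2) M := by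
  set d := f' (Pi.single j 1) with hd
  set η : ℝ := ‖d‖ / 2 with hη
  have hη0 : 0 < η := by have := norm_pos_iff.2 hj; positivity
  have hc : (0 : NNReal) < NNReal.mk η hη0.le := hη0
  obtain ⟨s, hs, hfs⟩ := hf.approximates_deriv_on_nhds (Or.inr hc)
  obtain ⟨s', hs', hΘs⟩ := hΘ.approximates_deriv_on_nhds (Or.inr hc)
  obtain ⟨r₁, hr₁, hball⟩ := Metric.mem_nhds_iff.1 (Filter.inter_mem hs hs')
  refine ⟨r₁, max ‖f'‖ ‖Θ'‖ + η, hr₁, by positivity, fun r₀ hr a ha => ?_⟩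
  have hsub : Metric.ball x₀ r₀ ⊆ s ∩ s' := (Metric.ball_subset_ball hr).trans hball
  refine regularAlong_of_approximates (D := ∑ i : Fin n, (a i.succ : ℚ_[p]) * d i +
    Θ' (Pi.single j 1)) hη0 (by rw [hη]; linarith) (fun y hy z hz => ?_)
    fun y hy v w hv hw => ?_
  · have h1 : ‖f y - f z‖ ≤ (max ‖f'‖ ‖Θ'‖ + η) * ‖y - z‖ := by
      have h2 : ‖f y - f z - f' (y - z)‖ ≤ η * ‖y - z‖ := hfs _ (hsub hy).1 _ (hsub hz).1
      have h3 := norm_le_norm_add_norm_sub' (f y - f z) (f' (y - z))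
      have h4 := f'.le_opNorm (y - z)
      nlinarith [le_max_left ‖f'‖ ‖Θ'‖, norm_nonneg (y - z)]
    have h1' : ‖Θ y - Θ z‖ ≤ (max ‖f'‖ ‖Θ'‖ + η) * ‖y - z‖ := by
      have h2 : ‖Θ y - Θ z - Θ' (y - z)‖ ≤ η * ‖y - z‖ := hΘs _ (hsub hy).2 _ (hsub hz).2
      have h3 := norm_le_norm_add_norm_sub' (Θ y - Θ z) (Θ' (y - z))
      have h4 := Θ'.le_opNorm (y - z)
      nlinarith [le_max_right ‖f'‖ ‖Θ'‖, norm_nonneg (y - z)]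
    have h5 := norm_int_combination_add_le (fun i => a i.succ) (by positivity) h1 h1'
    convert h5 using 2
    simp only [linForm, Pi.sub_apply, mul_sub, Finset.sum_sub_distrib]
    ring
  · have hy1 := hsub (add_single_mem_ball (j := j) hy hv)
    have hy2 := hsub (add_single_mem_ball (j := j) hy hw)
    have hsingle : y + Pi.single j v - (y + Pi.single j w) =
        (v - w) • (Pi.single j 1 : Fin m → ℚ_[p]) := by
      rw [add_sub_add_left_eq_sub, ← Pi.single_sub, ← Pi.single_smul, smul_eq_mul, mul_one]
    have hnorm : ‖(v - w) • (Pi.single j 1 : Fin m → ℚ_[p])‖ = ‖v - w‖ := by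
      rw [norm_smul, Pi.norm_single, norm_one, mul_one]
    have h1 : ‖f (y + Pi.single j v) - f (y + Pi.single j w) - (v - w) • d‖ ≤ η * ‖v - w‖ := by
      have : ‖_‖ ≤ η * ‖_‖ := hfs _ hy1.1 _ hy2.1
      rwa [hsingle, map_smul, hnorm] at this
    have h2 : ‖Θ (y + Pi.single j v) - Θ (y + Pi.single j w) - (v - w) • Θ' (Pi.single j 1)‖ ≤
        η * ‖v - w‖ := by
      have : ‖_‖ ≤ η * ‖_‖ := hΘs _ hy1.2 _ hy2.2
      rwa [hsingle, map_smul, hnorm] at this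
    have h5 := norm_int_combination_add_le (fun i => a i.succ) (by positivity) h1 h2
    convert h5 using 2
    simp only [linForm, Pi.sub_apply, Pi.smul_apply, smul_eq_mul, mul_sub, add_mul, Finset.sum_mul,
      Finset.sum_sub_distrib, sub_mul, mul_left_comm]
    simp only [mul_comm]
    ring

theorem exists_int_norm_le_norm_mul_add (d θ : ℚ_[p]) :
    ∃ e : ℤ, 1 ≤ e ∧ e ≤ 2 ∧ ‖d‖ ≤ ‖e * d + θ‖ := by
  by_contra! h
  have h1 := h 1 le_rfl one_le_two
  have h2 := h 2 one_le_two le_rfl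
  have h3 := IsUltrametricDist.norm_add_le_max (((2 : ℤ) : ℚ_[p]) * d + θ)
    (-(((1 : ℤ) : ℚ_[p]) * d + θ))
  rw [norm_neg] at h3
  have h4 : ((2 : ℤ) : ℚ_[p]) * d + θ + -(((1 : ℤ) : ℚ_[p]) * d + θ) = d := by
    push_cast; ring
  rw [h4] at h3
  exact (h3.trans_lt (max_lt h2 h1)).false

/-- Changing the coefficients by multiples of `p²` does not make a combination of the `d_i` smaller
than `‖d‖`, if it was not smaller to begin with. -/
theorem norm_le_norm_combination_of_congr {d : Fin n → ℚ_[p]} (hd : d ≠ 0) (θ : ℚ_[p])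
    {a b c : Fin n → ℤ} (habc : ∀ i, a i = b i + p ^ 2 * c i)
    (hb : ‖d‖ ≤ ‖∑ i, (b i : ℚ_[p]) * d i + θ‖) : ‖d‖ ≤ ‖∑ i, (a i : ℚ_[p]) * d i + θ‖ := by
  have hd0 := norm_pos_iff.2 hd
  have hp : (1 : ℝ) < p := by exact_mod_cast (Fact.out : p.Prime).one_lt
  have h1 : ‖(p : ℚ_[p]) ^ 2 * (∑ i, (c i : ℚ_[p]) * d i)‖ < ‖d‖ := by
    have h2 := norm_int_combination_add_le c hd0.le le_rfl (by rw [norm_zero]; exact hd0.le :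
      ‖(0 : ℚ_[p])‖ ≤ ‖d‖)
    rw [add_zero] at h2
    rw [norm_mul, norm_pow, Padic.norm_p]
    have h3 : ((p : ℝ)⁻¹) ^ 2 < 1 :=
      pow_lt_one₀ (by positivity) (inv_lt_one_of_one_lt₀ hp) two_ne_zero
    calc _ ≤ ((p : ℝ)⁻¹) ^ 2 * ‖d‖ := by gcongr
      _ < 1 * ‖d‖ := by gcongr
      _ = ‖d‖ := one_mul _
  have h4 : ∑ i, (b i : ℚ_[p]) * d i + θ = (∑ i, (a i : ℚ_[p]) * d i + θ) +
      -((p : ℚ_[p]) ^ 2 * (∑ i, (c i : ℚ_[p]) * d i)) := by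
    simp only [habc, Int.cast_add, Int.cast_mul, Int.cast_pow, Int.cast_natCast, add_mul,
      Finset.sum_add_distrib, Finset.mul_sum, mul_assoc]
    ring
  by_contra! h
  have h5 := IsUltrametricDist.norm_add_le_max (∑ i, (a i : ℚ_[p]) * d i + θ)
    (-((p : ℚ_[p]) ^ 2 * (∑ i, (c i : ℚ_[p]) * d i)))
  rw [norm_neg, ← h4] at h5
  exact (hb.trans (h5.trans (max_le_max le_rfl le_rfl))).not_gt (max_lt h h1)

/-- At a point where no `a_0 + a_1 f_1 + ⋯ + a_n f_n` with `‖a‖ ≤ Q` is small, some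
`a_0 + a_1 f_1 + ⋯ + a_n f_n + Θ` with `‖a‖ ≪ Q` is small, while the same combination of
derivatives `d ≠ 0` of `f` and `θ` of `Θ` is not smaller than `d`. The coefficients `a_1, …, a_n`
are prescribed modulo `p²`, as `1` or `2` where `|d_i|` is largest and as `0` elsewhere; this also makes
`a` nonzero. -/
theorem exists_small_linForm_add {U : Set (Fin m → ℚ_[p])}
    {f : (Fin m → ℚ_[p]) → (Fin n → ℚ_[p])} {Θ : (Fin m → ℚ_[p]) → ℚ_[p]} {x : Fin m → ℚ_[p]}
    (hx : x ∈ U) (hfx : ‖f x‖ ≤ 1) (hΘx : ‖Θ x‖ ≤ 1) {Q δ : ℝ} (hQ : 1 ≤ Q) (hδ : 0 < δ)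
    (hδ1 : δ < 1) (hxQ : x ∉ smallValueSet U f Q δ) {d : Fin n → ℚ_[p]} (hd : d ≠ 0) (θ : ℚ_[p]) :
    ∃ a : Fin (n + 1) → ℤ, a ≠ 0 ∧ ‖a‖ ≤ p ^ 2 * (3 * ⌈p / δ⌉₊ + 1) * Q ∧
      ‖d‖ ≤ ‖∑ i : Fin n, (a i.succ : ℚ_[p]) * d i + θ‖ ∧
      ‖linForm f a x + Θ x‖ < δ * (Q ^ (n + 1))⁻¹ := by
  have hp2 : 2 ≤ p := (Fact.out : p.Prime).two_le
  have hp4 : (4 : ℤ) ≤ p ^ 2 := by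
    have : (2 : ℤ) ≤ p := by exact_mod_cast hp2
    nlinarith
  obtain ⟨k, hk⟩ := Function.ne_iff.1 hd
  have : Nonempty (Fin n) := ⟨k⟩
  obtain ⟨i₀, hi₀⟩ := Finite.exists_max fun i => ‖d i‖
  have hdi₀ : ‖d‖ = ‖d i₀‖ :=
    le_antisymm ((pi_norm_le_iff_of_nonneg (norm_nonneg _)).2 hi₀) (norm_le_pi_norm d i₀)
  obtain ⟨e, he1, he2, he⟩ := exists_int_norm_le_norm_mul_add (d i₀) θ
  have hint : ∀ u : ℚ_[p], ‖u‖ ≤ 1 → ∃ z : ℤ_[p], (z : ℚ_[p]) = u := fun u hu => ⟨⟨u, hu⟩, rfl⟩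
  choose F hF using fun i => hint (f x i) ((norm_le_pi_norm (f x) i).trans hfx)
  obtain ⟨z, hz⟩ := hint (Θ x) hΘx
  have hcoe : ∀ a : Fin (n + 1) → ℤ,
      (((a 0 : ℤ_[p]) + ∑ i : Fin n, (a i.succ : ℤ_[p]) * F i : ℤ_[p]) : ℚ_[p]) =
        linForm f a x := by
    intro a
    simp only [linForm, PadicInt.coe_add, PadicInt.coe_sum, PadicInt.coe_mul,
      PadicInt.coe_intCast, hF]
  obtain ⟨a, ha, ⟨c, hc⟩, hsmall⟩ := exists_inhomogeneous_approximation F z hQ hδ hδ1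
    (fun a ha haQ => by
      rw [PadicInt.norm_def, hcoe]
      by_contra! h
      exact hxQ ⟨hx, a, ha, h, haQ⟩)
    (Pi.single i₀ e) (fun i => by
      rcases eq_or_ne i i₀ with rfl | h
      · rw [Pi.single_eq_same, abs_of_nonneg (by omega)]; omega
      · rw [Pi.single_eq_of_ne h, abs_zero]; positivity)
  refine ⟨a, ?_, ha, norm_le_norm_combination_of_congr hd θ hc ?_, ?_⟩
  · rintro rfl
    have h0 := hc i₀
    rw [Pi.zero_apply, Pi.single_eq_same] at h0
    have hdvd : ((p : ℤ) ^ 2) ∣ e := ⟨-c i₀, by linarith⟩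
    have := Int.le_of_dvd (by omega) hdvd
    omega
  · rw [Finset.sum_eq_single i₀ (fun i _ h => by simp [Pi.single_eq_of_ne h]) (by simp),
      Pi.single_eq_same, hdi₀]
    exact he
  · rw [PadicInt.norm_def, PadicInt.coe_add, hcoe, hz] at hsmall
    exact hsmall

end LinearForms

/-! ### Local ubiquity -/

section Ubiquity

variable {p : ℕ} [Fact p.Prime] {m n : ℕ}

theorem isOpen_openBox (c : Fin m → ℚ_[p]) (r : Fin m → ℝ) : IsOpen (openBox c r) :=
  isOpen_set_pi Set.finite_univ fun _ _ => Metric.isOpen_ball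

/-- If `S Q` asymptotically takes up at most the proportion `w < 1` of `B`, then for large `Q` the
rest of `B` takes up at least the proportion `(1 - w) / 2`. No measurability is needed. -/
theorem eventually_le_volume_of_limsup_le {X : Type*} [MeasurableSpace X] {μ : Measure X}
    {B : Set X} (hB0 : μ B ≠ 0) (hB : μ B ≠ ⊤) {S : ℝ → Set X} {w : ℝ} (hw0 : 0 < w) (hw1 : w < 1)
    (hlim : limsup (fun Q => μ (S Q ∩ B)) atTop ≤ ENNReal.ofReal w * μ B) :
    ∀ᶠ Q in atTop, ∀ E : Set X, B \ S Q ⊆ E →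
      ENNReal.ofReal ((1 - w) / 2) * μ B ≤ μ (E ∩ B) := by
  have hlt : ENNReal.ofReal w * μ B < ENNReal.ofReal ((1 + w) / 2) * μ B :=
    ENNReal.mul_lt_mul_left hB0 hB
      ((ENNReal.ofReal_lt_ofReal_iff (by linarith)).2 (by linarith))
  filter_upwards [eventually_lt_of_limsup_lt (hlim.trans_lt hlt)] with Q hQ E hE
  have h1 : μ B ≤ μ (S Q ∩ B) + μ (E ∩ B) := by
    refine (measure_mono fun x hx => ?_).trans (measure_union_le _ _)
    by_cases hxS : x ∈ S Q
    · exact Or.inl ⟨hxS, hx⟩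
    · exact Or.inr ⟨hE ⟨hx, hxS⟩, hx⟩
  have h2 : ENNReal.ofReal ((1 + w) / 2) * μ B + ENNReal.ofReal ((1 - w) / 2) * μ B = μ B := by
    rw [← add_mul, ← ENNReal.ofReal_add (by linarith) (by linarith)]
    ring_nf
    simp
  have h3 : ENNReal.ofReal ((1 + w) / 2) * μ B + ENNReal.ofReal ((1 - w) / 2) * μ B ≤
      ENNReal.ofReal ((1 + w) / 2) * μ B + μ (E ∩ B) := by
    rw [h2]
    exact h1.trans (by gcongr)
  exact (ENNReal.add_le_add_iff_left (ENNReal.mul_ne_top ENNReal.ofReal_ne_top hB)).1 h3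

theorem exists_apply_single_ne_zero {E : Type*} [NormedAddCommGroup E] [NormedSpace ℚ_[p] E]
    {L : (Fin m → ℚ_[p]) →L[ℚ_[p]] E} (hL : L ≠ 0) : ∃ j, L (Pi.single j 1) ≠ 0 := by
  by_contra! h
  refine hL (ContinuousLinearMap.coe_injective (LinearMap.pi_ext fun j x => ?_))
  have : (Pi.single j x : Fin m → ℚ_[p]) = x • Pi.single j 1 := by
    rw [← Pi.single_smul, smul_eq_mul, mul_one]
  simp [this, h j]

theorem finite_setOf_mul_norm_le {κ : ℝ} (hκ : 0 < κ) (R : ℝ) :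
    {a : {a : Fin (n + 1) → ℤ // a ≠ 0} | κ * ‖a.1‖ ≤ R}.Finite := by
  have h : (Metric.closedBall (0 : Fin (n + 1) → ℤ) (R / κ)).Finite :=
    (isCompact_closedBall _ _).finite_of_discrete
  refine (h.preimage Subtype.val_injective.injOn).subset fun a ha => ?_
  rw [Set.mem_preimage, mem_closedBall_zero_iff, le_div_iff₀ hκ, mul_comm]
  exact ha

end Ubiquity

end PadicUbiquity

theorem theorem5p7 (p : ℕ) [Fact p.Prime] (m n : ℕ)
    (U : Set (Fin m → ℚ_[p])) (hU : ∃ c r, U = PadicUbiquity.openBox c r)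
    (f : (Fin m → ℚ_[p]) → (Fin n → ℚ_[p]))
    (hf_an : PadicUbiquity.AnalyticUpToBoundary U f)
    (hf_ind : PadicUbiquity.LocallyIndependent U f)
    (hf_bdd : PadicUbiquity.UnitBounded U f)
    (Θ : (Fin m → ℚ_[p]) → ℚ_[p])
    (hΘ_an : PadicUbiquity.AnalyticUpToBoundary U Θ)
    (hΘ_bdd : PadicUbiquity.UnitBounded U Θ)
    (x₀ : Fin m → ℚ_[p]) (hx₀ : x₀ ∈ U)
    (h_nice : PadicUbiquity.NiceAt U f x₀)
    (h_reg : fderiv ℚ_[p] f x₀ ≠ 0) :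
    ∃ r₀ : ℝ, 0 < r₀ ∧ Metric.ball x₀ r₀ ⊆ U ∧
      ∃ κ₀ κ₁ : ℝ, 0 < κ₀ ∧ 0 < κ₁ ∧
        ∃ R : {a : Fin (n + 1) → ℤ // a ≠ 0} → Set (Fin m → ℚ_[p]),
          (∀ a, R a ⊆ {x ∈ U | PadicUbiquity.linForm f a.1 x + Θ x = 0} ∩ Metric.ball x₀ r₀) ∧
          PadicUbiquity.IsLocallyUbiquitous (Metric.ball x₀ r₀) R (fun a => κ₀ * ‖a.1‖)
            (fun r => κ₁ * (r ^ (n + 1))⁻¹) ((m : ℝ) - 1) := by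
  have hUo : IsOpen U := by
    obtain ⟨c, r, rfl⟩ := hU
    exact PadicUbiquity.isOpen_openBox c r
  obtain ⟨j, hj⟩ := PadicUbiquity.exists_apply_single_ne_zero h_reg
  obtain ⟨r₁, M, hr₁, hM, hreg⟩ := PadicUbiquity.exists_regularAlong
    (hf_an.hasStrictFDerivAt hUo hx₀) (hΘ_an.hasStrictFDerivAt hUo hx₀) hj
  obtain ⟨V, hV, hVU, δ, w, hδ0, hδ1, hw0, hw1, ε, hε, hnice⟩ := h_nice
  obtain ⟨r₂, hr₂, hr₂V⟩ := Metric.mem_nhds_iff.1 hV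
  set d := fderiv ℚ_[p] f x₀ (Pi.single j 1) with hd
  set θ := fderiv ℚ_[p] Θ x₀ (Pi.single j 1) with hθ
  have hd0 : 0 < ‖d‖ := norm_pos_iff.2 hj
  set η : ℝ := ‖d‖ / 2 with hη
  have hη0 : 0 < η := by positivity
  set r₀ : ℝ := min r₁ (min r₂ (ε / 2)) with hr₀
  have hr₀0 : 0 < r₀ := by positivity
  have hr₀1 : r₀ ≤ r₁ := min_le_left _ _
  have hr₀2 : r₀ ≤ r₂ := (min_le_right _ _).trans (min_le_left _ _)
  have hr₀ε : r₀ < ε := ((min_le_right _ _).trans (min_le_right _ _)).trans_lt (by linarith)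
  have hBV : Metric.ball x₀ r₀ ⊆ V := (Metric.ball_subset_ball hr₀2).trans hr₂V
  have hBU : Metric.ball x₀ r₀ ⊆ U := hBV.trans hVU
  have hp0 : (0 : ℝ) < p := by exact_mod_cast (Fact.out : p.Prime).pos
  have hm1 : (1 : ℝ) ≤ m := by exact_mod_cast j.pos
  set C : ℝ := p ^ 2 * (3 * ⌈p / δ⌉₊ + 1) with hC
  have hC0 : 0 < C := by positivity
  set ρ : ℝ → ℝ := fun r => δ / η * (r ^ (n + 1))⁻¹ with hρ
  have hρ_lim : Tendsto ρ atTop (𝓝 0) := by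
    have := (tendsto_pow_atTop (α := ℝ) (Nat.succ_ne_zero n)).inv_tendsto_atTop.const_mul (δ / η)
    rwa [mul_zero] at this
  have hpow : Tendsto (fun t : ℕ => (2 : ℝ) ^ t) atTop atTop :=
    tendsto_pow_atTop_atTop_of_one_lt one_lt_two
  have hρr₀ : ∀ᶠ t : ℕ in atTop, ρ (2 ^ t) ≤ r₀ :=
    (hρ_lim.comp hpow).eventually_le_const hr₀0
  set G : (Fin (n + 1) → ℤ) → (Fin m → ℚ_[p]) → ℚ_[p] :=
    fun a x => PadicUbiquity.linForm f a x + Θ x with hG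
  -- Forms whose derivative along the `j`-th coordinate is small get an empty resonant set.
  set R : {a : Fin (n + 1) → ℤ // a ≠ 0} → Set (Fin m → ℚ_[p]) := fun a =>
    {x ∈ Metric.ball x₀ r₀ | G a.1 x = 0 ∧
      ‖d‖ ≤ ‖∑ i : Fin n, ((a.1 i.succ : ℤ) : ℚ_[p]) * d i + θ‖} with hR
  have hR_eq : ∀ a : {a : Fin (n + 1) → ℤ // a ≠ 0},
      ‖d‖ ≤ ‖∑ i : Fin n, ((a.1 i.succ : ℤ) : ℚ_[p]) * d i + θ‖ →
      R a = {x ∈ Metric.ball x₀ r₀ | G a.1 x = 0} := by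
    intro a ha
    ext x
    exact ⟨fun hx => ⟨hx.1, hx.2.1⟩, fun hx => ⟨hx.1, hx.2, ha⟩⟩
  refine ⟨r₀, hr₀0, hBU, C⁻¹, δ / η, by positivity, by positivity, R, fun a x hx => ?_, ?_⟩
  · exact ⟨⟨hBU hx.1, hx.2.1⟩, hx.1⟩
  refine ⟨fun r hr => by positivity, hρ_lim,
    fun a => mul_pos (by positivity) (norm_pos_iff.2 a.2),
    fun t => PadicUbiquity.finite_setOf_mul_norm_le (by positivity) _, by linarith, by linarith,
    ?_, ?_⟩
  · obtain ⟨T, hT⟩ := eventually_atTop.1 hρr₀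
    refine ⟨(1 / (2 * (M / η + 1)) / p ^ 2) ^ m / p, (p ^ 2) ^ m * p * (3 * (M / η) + 1),
      by positivity, by positivity, T, fun t ht a _ c hc l hl hlρ => ⟨?_, fun a' y _ r hr _ => ?_⟩⟩
    · rw [hR_eq a hc.2.2]
      exact (hreg r₀ hr₀1 a.1 hc.2.2).le_volume_inter_nbhd hη0 hM hc.1 hc.2.1 hl hlρ (hT t ht)
    · rw [hR_eq a hc.2.2]
      refine (measure_mono ?_).trans
        ((hreg r₀ hr₀1 a.1 hc.2.2).volume_inter_nbhd_le hη0 hM c y hl hr)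
      exact Set.inter_subset_inter_left _ Set.inter_subset_left
  · refine ⟨(1 - w) / 2, by linarith, fun y r hr hyr => ?_⟩
    -- A ball contained in `B(x₀, r₀)` is also a ball of radius at most `r₀`.
    obtain ⟨r', hr'0, hr'r₀, hr'⟩ : ∃ r', 0 < r' ∧ r' ≤ r₀ ∧
        Metric.ball y r = Metric.ball y r' := by
      rcases le_total r r₀ with h | h
      · exact ⟨r, hr, h, rfl⟩
      · refine ⟨r₀, hr₀0, le_rfl, (hyr.trans_eq ?_).antisymm (Metric.ball_subset_ball h)⟩
        exact IsUltrametricDist.ball_eq_of_mem (hyr (Metric.mem_ball_self hr))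
    rw [hr'] at hyr ⊢
    have hlarge := PadicUbiquity.eventually_le_volume_of_limsup_le
      (Metric.measure_ball_pos volume y hr'0).ne' measure_ball_lt_top.ne hw0 hw1
      (hnice y r' hr'0 (hr'r₀.trans_lt hr₀ε) (hyr.trans hBV))
    refine le_liminf_of_le (by isBoundedDefault) ?_
    filter_upwards [hpow.eventually hlarge, hρr₀] with t ht hρt
    refine ht _ ?_
    rintro x ⟨hxy, hxQ⟩
    have hx := hyr hxy
    have hQ1 : (1 : ℝ) ≤ 2 ^ t := one_le_pow₀ one_le_two
    obtain ⟨a, ha0, haQ, had, hax⟩ := PadicUbiquity.exists_small_linForm_add (hBU hx)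
      (hf_bdd.norm_le x (hBU hx)) (hΘ_bdd.norm_le x (hBU hx)) hQ1 hδ0 hδ1 hxQ hj θ
    have hηρ : η * ρ (2 ^ t) = δ * (((2 : ℝ) ^ t) ^ (n + 1))⁻¹ := by
      simp only [hρ]
      field_simp
    rw [← hηρ] at hax
    obtain ⟨v, hv, hvB, hGv⟩ := (hreg r₀ hr₀1 a had).exists_zero x hx
      (hax.trans_le (by gcongr))
    refine Set.mem_iUnion₂.2 ⟨⟨a, ha0⟩, ?_, hx, ?_⟩
    · change C⁻¹ * ‖a‖ ≤ 2 ^ t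
      rwa [inv_mul_le_iff₀ hC0]
    · refine Metric.mem_thickening_iff.2 ⟨_, ⟨hvB, hGv, had⟩, ?_⟩
      rw [dist_comm, dist_eq_norm, add_sub_cancel_left, Pi.norm_single]
      exact lt_of_mul_lt_mul_left (hv.trans_lt hax) hη0.le
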